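/- Let $\mathscr{P}$ be the set of integer partitions, $|\lambda|$ the size of $\lambda$, and $r_m(\lambda)$ the number of parts of $\lambda$ equal to $m$. For $f:\mathscr{P}\to\mathbb{Q}$ put $$\langle f\rangle_q=\frac{\sum_\lambda f(\lambda)q^{|\lambda|}}{\sum_\lambda q^{|\lambda|}}\in\mathbb{Q}[[q]],\qquad \langle f\rangle_{\vec u}=\frac{\sum_\lambda f(\lambda)u_\lambda}{\sum_\lambda u_\lambda}\in\mathbb{Q}[[u_1,u_2,\ldots]],\qquad u_\lambda=u_{\lambda_1}u_{\lambda_2}\cdots,$$ and let the induced product $f\odot g$ be the function on partitions determined by $\langle f\odot g\rangle_{\vec u}=\langle f\rangle_{\vec u}\langle g\rangle_{\vec u}$; its unit is the constant function $1$, which is the value of the empty product. For integers $k\ge 0$, $l\ge 1$ let $$T_{k,l}(\lambda)=-\frac{B_{k+l}}{2(k+l)}(\delta_{l,1}+\delta_{k,0})+\sum_{m\ge1}m^k\,\mathcal{F}_l(r_m(\lambda)),\qquad \mathcal{F}_l(r)=\sum_{i=1}^r i^{l-1},$$ where $B_j$ is the $j$-th Bernoulli number; moreover let $T_{0,0}=T_{-1,1}=-\tfrac12$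 (constant functions) and $T_{k,l}=0$ for all other pairs of integers $(k,l)$ with $k<0$ or $l<1$. For $n\ge0$ the $n$-point function is the formal Laurent series $$F_n(u_1,\ldots,u_n,v_1,\ldots,v_n)=\sum_{\vec k,\vec l}\langle T_{k_1,l_1}\odot\cdots\odot T_{k_n,l_n}\rangle_q\,\frac{u_1^{k_1}\cdots u_n^{k_n}\,v_1^{l_1-1}\cdots v_n^{l_n-1}}{k_1!\cdots k_n!\,(l_1-1)!\cdots(l_n-1)!},$$ the sum being over all integers $k_i,l_i$ with $k_i+l_i$ even for all $i$, and with $m!:=1$ for $m<0$. The partition function is the formal power series $$\Phi(\vec t)=\sum_{n\ge0}\frac1{n!}\sum_{\vec k,\vec l}\langle T_{k_1,l_1}\odot\cdots\odot T_{k_n,l_n}\rangle_q\,t_{k_1,l_1}\cdots t_{k_n,l_n}$$ in variables $t_{k,l}$ with $k\ge0$, $l\ge1$, $k+l$ even (all indices in the sum being of this kind). Let $$\theta(z)=\sum_{\nu\in\mathbb{Z}+\frac12}(-1)^{\lfloor\nu\rfloor}e^{\nu z}q^{\nu^2/2}$$ be the Jacobi theta series, as a formal power series in $z$ whose coefficients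 are formal series in rational powers of $q$. **Theorem.** As identities of formal series: 1. For all $n\ge0$, $F_n(\vec u,\vec v)=\prod_{i=1}^nF_1(u_i,v_i)$. 2. $\theta(u)\theta(v)$ is invertible as a formal Laurent series in $u,v$, and $$F_1(u,v)=-\frac12\,\frac{\theta'(0)\,\theta(u+v)}{\theta(u)\,\theta(v)}.$$ 3. $$\Phi(\vec t)=\exp\Bigl([x^0y^0]\,F_1\bigl(\tfrac{\partial}{\partial x},\tfrac{\partial}{\partial y}\bigr)\sum_{k,l}t_{k,l}\,x^ky^{l-1}\Bigr),$$ where the sum is over $k\ge0$, $l\ge1$ with $k+l$ even, $[x^0y^0]$ denotes taking the constant coefficient in $x,y$, both act coefficientwise in the $t_{k,l}$, and $\bigl(\tfrac{\partial}{\partial x}\bigr)^{-1}$, $\bigl(\tfrac{\partial}{\partial y}\bigr)^{-1}$ denote formal integration without constant of integration. -/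

import Mathlib

noncomputable section

namespace PartitionBracket

/-! ## Functions on partitions, the q-bracket and the induced product -/

/-- The set of all integer partitions (of all non-negative integers). -/
abbrev Ptn : Type := Σ n : ℕ, n.Partition

/-- The multiplicity `r_m(lam)` of the part `m` in the partition `lam`. -/
def mult (lam : Ptn) (m : ℕ) : ℕ := lam.2.parts.count m

/-- `∑_lam f(lam) q^|lam|`. -/
def qGen (f : Ptn → ℚ) : PowerSeries ℚ :=
  PowerSeries.mk fun n => ∑ lam : n.Partition, f ⟨n, lam⟩

/-- The `q`-bracket `⟨f⟩_q = (∑_lam f(lam) q^|lam|) / (∑_lam q^|lam|)`; the denominator has constant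
term `1`, so that the inverse is the inverse of power series. -/
def qBracket (f : Ptn → ℚ) : PowerSeries ℚ := qGen f * (qGen 1)⁻¹

/-- The exponent of the monomial `u_lam = u_{lam_1} u_{lam_2} ⋯` in the variables `u_1, u_2, …`:
the variable `u_m` occurs `r_m(lam)` times. -/
def exponent (lam : Ptn) : ℕ+ →₀ ℕ :=
  Finsupp.onFinset (lam.2.parts.toFinset.preimage PNat.val PNat.coe_injective.injOn)
    (fun m => mult lam m) (by
      intro m hm
      simpa [mult, Multiset.count_eq_zero] using hm)

/-- The partition with given multiplicities. -/
def ofExponent (e : ℕ+ →₀ ℕ) : Ptn :=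
  ⟨((Finsupp.toMultiset e).map PNat.val).sum,
    { parts := (Finsupp.toMultiset e).map PNat.val
      parts_pos := by
        intro i hi
        obtain ⟨m, -, rfl⟩ := Multiset.mem_map.1 hi
        exact m.pos
      parts_sum := rfl }⟩

theorem exponent_ofExponent (e : ℕ+ →₀ ℕ) : exponent (ofExponent e) = e := by
  ext m
  change Multiset.count (m : ℕ) ((Finsupp.toMultiset e).map PNat.val) = e m
  rw [Multiset.count_map_eq_count' _ _ PNat.coe_injective, Finsupp.count_toMultiset]

theorem ofExponent_exponent (lam : Ptn) : ofExponent (exponent lam) = lam := by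
  have h : (Finsupp.toMultiset (exponent lam)).map PNat.val = lam.2.parts := by
    ext i
    rcases Nat.eq_zero_or_pos i with rfl | hi
    · rw [Multiset.count_eq_zero_of_notMem, Multiset.count_eq_zero_of_notMem]
      · intro h0
        exact lt_irrefl _ (lam.2.parts_pos h0)
      · intro h0
        obtain ⟨m, -, hm⟩ := Multiset.mem_map.1 h0
        exact m.ne_zero hm
    · lift i to ℕ+ using hi
      exact (Multiset.count_map_eq_count' PNat.val (Finsupp.toMultiset (exponent lam))
        PNat.coe_injective i).trans (by simp [exponent, mult])
  obtain ⟨n, p⟩ := lam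
  have hn : ((Finsupp.toMultiset (exponent ⟨n, p⟩)).map PNat.val).sum = n := by
    rw [h]; exact p.parts_sum
  refine Sigma.ext hn ?_
  have key : ∀ (a : ℕ) (x : a.Partition), a = n → x.parts = p.parts → HEq x p := by
    rintro a x rfl hx
    exact heq_of_eq (Nat.Partition.ext hx)
  exact key _ _ hn h

/-- `∑_lam f(lam) u_lam`, a power series in the variables `u_1, u_2, …`. -/
def uGen (f : Ptn → ℚ) : MvPowerSeries ℕ+ ℚ := fun e => f (ofExponent e)

/-- The `u`-bracket `⟨f⟩_u = (∑_lam f(lam) u_lam) / (∑_lam u_lam)`. -/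
def uBracket (f : Ptn → ℚ) : MvPowerSeries ℕ+ ℚ := uGen f * (uGen 1)⁻¹

/-- The induced product `f ⊙ g`, i.e. the function on partitions with
`⟨f ⊙ g⟩_u = ⟨f⟩_u ⟨g⟩_u` (see `uBracket_inducedMul`, `uBracket_injective`). -/
def inducedMul (f g : Ptn → ℚ) : Ptn → ℚ := fun lam =>
  MvPowerSeries.coeff (exponent lam) (uBracket f * uBracket g * uGen 1)

theorem constantCoeff_uGen_one : MvPowerSeries.constantCoeff (uGen 1) ≠ (0 : ℚ) := by
  change (1 : ℚ) ≠ 0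
  exact one_ne_zero

theorem uBracket_inducedMul (f g : Ptn → ℚ) :
    uBracket (inducedMul f g) = uBracket f * uBracket g := by
  have h : uGen (inducedMul f g) = uBracket f * uBracket g * uGen 1 := by
    ext e
    change MvPowerSeries.coeff (exponent (ofExponent e)) (uBracket f * uBracket g * uGen 1) = _
    rw [exponent_ofExponent]
  rw [uBracket, h, mul_assoc, MvPowerSeries.mul_inv_cancel _ constantCoeff_uGen_one, mul_one]

theorem uBracket_injective : Function.Injective uBracket := by
  have key : ∀ f, uGen f = uBracket f * uGen 1 := by
    intro f
    rw [uBracket, mul_assoc, MvPowerSeries.inv_mul_cancel _ constantCoeff_uGen_one, mul_one]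
  intro f g h
  have h' : uGen f = uGen g := by rw [key f, key g, h]
  funext lam
  have := congrFun h' (exponent lam)
  simpa [uGen, ofExponent_exponent] using this

/-- The induced product `f_1 ⊙ ⋯ ⊙ f_n`; for `n = 0` it is the unit of `⊙`, the constant
function `1`. -/
def inducedProd {n : ℕ} (f : Fin n → Ptn → ℚ) : Ptn → ℚ := (List.ofFn f).foldr inducedMul 1

theorem uGen_zero : uGen 0 = 0 := rfl

theorem inducedMul_zero_left (g : Ptn → ℚ) : inducedMul 0 g = 0 := by
  funext lam
  simp [inducedMul, uBracket, uGen_zero]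

theorem inducedMul_zero_right (g : Ptn → ℚ) : inducedMul g 0 = 0 := by
  funext lam
  simp [inducedMul, uBracket, uGen_zero]

theorem inducedProd_eq_zero {n : ℕ} (f : Fin n → Ptn → ℚ) (i : Fin n) (hi : f i = 0) :
    inducedProd f = 0 := by
  have key : ∀ L : List (Ptn → ℚ), 0 ∈ L → L.foldr inducedMul 1 = 0 := by
    intro L
    induction L with
    | nil => simp
    | cons a L ih =>
      intro h
      rcases List.mem_cons.1 h with h | h
      · rw [List.foldr_cons, ← h, inducedMul_zero_left]
      · rw [List.foldr_cons, ih h, inducedMul_zero_right]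
  exact key _ ((List.mem_ofFn' f 0).2 ⟨i, hi⟩)

theorem qBracket_zero : qBracket 0 = 0 := by
  have : qGen 0 = 0 := by ext n; simp [qGen]
  rw [qBracket, this, zero_mul]

/-- The value `F_l(r) = ∑_{i=1}^r i^{l-1}` of the Faulhaber polynomial of degree `l ≥ 1`. -/
def faulhaber (l r : ℕ) : ℚ := ∑ i ∈ Finset.Icc 1 r, (i : ℚ) ^ (l - 1)

/-- The double moment functions. For `k ≥ 0`, `l ≥ 1`,
`T_{k,l}(lam) = -B_{k+l}/(2(k+l)) (δ_{l,1} + δ_{k,0}) + ∑_{m ≥ 1} m^k F_l(r_m(lam))`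
(the parts of `lam` are at most `|lam|`, and `F_l(0) = 0`); moreover
`T_{0,0} = T_{-1,1} = -1/2`, and `T_{k,l} = 0` for all other pairs of integers. -/
def T (k l : ℤ) : Ptn → ℚ := fun lam =>
  if 0 ≤ k ∧ 1 ≤ l then
    -(bernoulli (k + l).toNat / (2 * (k + l : ℚ))) *
        ((if l = 1 then 1 else 0) + (if k = 0 then 1 else 0))
      + ∑ m ∈ Finset.Icc 1 lam.1, (m : ℚ) ^ k.toNat * faulhaber l.toNat (mult lam m)
  else if (k = 0 ∧ l = 0) ∨ (k = -1 ∧ l = 1) then -1 / 2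
  else 0

theorem T_eq_zero {k l : ℤ} (h : k < -1 ∨ l < 0) : T k l = 0 := by
  funext lam
  have h1 : ¬ (0 ≤ k ∧ 1 ≤ l) := by omega
  have h2 : ¬ ((k = 0 ∧ l = 0) ∨ (k = -1 ∧ l = 1)) := by omega
  simp [T, h1, h2]

/-! ## Coefficients: formal series in rational powers of `q` -/

/-- Formal series in `q` with rational coefficients and rational exponents. -/
abbrev K : Type := HahnSeries ℚ ℚ

/-- The `q`-bracket, as an element of `K`. -/
def bracket (f : Ptn → ℚ) : K := HahnSeries.ofPowerSeries ℚ ℚ (qBracket f)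

/-! ## Formal Laurent series in several variables -/

/-- Formal Laurent series in the variables `x_s`, `s ∈ σ`, with coefficients in `K`. -/
abbrev Laurent (σ : Type) : Type := HahnSeries (σ → ℤ) K

/-- The constant Laurent series. -/
abbrev const {σ : Type} : K →+* Laurent σ := HahnSeries.C

/-- A formal power series, as a Laurent series. -/
def ofMvPowerSeries (σ : Type) [Finite σ] : MvPowerSeries σ K →+* Laurent σ :=
  (HahnSeries.embDomainRingHom
      ({ toFun := fun e s => (e s : ℤ)
         map_zero' := by ext; simp
         map_add' := by intros; ext; simp } : (σ →₀ ℕ) →+ (σ → ℤ))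
      (by
        intro a b h
        ext s
        exact Int.ofNat_inj.1 (congrFun h s))
      (by
        intro a b
        simp [Pi.le_def, Finsupp.le_def])).comp
    (HahnSeries.toMvPowerSeries (σ := σ) (R := K)).symm.toRingHom

/-- Rename the variables of a Laurent series along an injection `i : σ → τ`. -/
def rename {σ τ : Type} (i : σ ↪ τ) : Laurent σ →+* Laurent τ :=
  HahnSeries.embDomainRingHom
    ({ toFun := fun e => Function.extend i e 0
       map_zero' := by
        ext t
        by_cases h : ∃ s, i s = t
        · obtain ⟨s, rfl⟩ := h
          simp [i.injective.extend_apply]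
        · simp [Function.extend_apply' _ _ _ h]
       map_add' := by
        intro a b
        ext t
        by_cases h : ∃ s, i s = t
        · obtain ⟨s, rfl⟩ := h
          simp [i.injective.extend_apply]
        · simp [Function.extend_apply' _ _ _ h] } : (σ → ℤ) →+ (τ → ℤ))
    (by
      intro a b h
      funext s
      have := congrFun h (i s)
      simpa [i.injective.extend_apply] using this)
    (by
      intro a b
      constructor
      · intro h s
        have := h (i s)
        simpa [i.injective.extend_apply] using this
      · intro h t
        by_cases ht : ∃ s, i s = t
        · obtain ⟨s, rfl⟩ := ht
          simpa [i.injective.extend_apply] using h s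
        · simp [Function.extend_apply' _ _ _ ht])

theorem isPWO_of_bddBelow {σ : Type} [Finite σ] (S : Set (σ → ℤ)) (hS : ∀ e ∈ S, ∀ s, -1 ≤ e s) :
    S.IsPWO := by
  have h : ((fun (f : σ → ℕ) (s : σ) => (f s : ℤ) - 1) '' Set.univ).IsPWO := by
    refine Set.IsPWO.image_of_monotone (Set.isPWO_of_wellQuasiOrderedLE _) ?_
    intro f g hfg s
    have : f s ≤ g s := hfg s
    dsimp only
    omega
  refine h.mono ?_
  intro e he
  refine ⟨fun s => (e s + 1).toNat, trivial, ?_⟩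
  funext s
  have := hS e he s
  dsimp only
  omega

/-! ## The n-point functions -/

/-- The variables `u_1, …, u_n` and `v_1, …, v_n`. -/
abbrev Vars (n : ℕ) : Type := Fin n ⊕ Fin n

/-- `m!` for `m ≥ 0`, and `1` for `m < 0`. -/
def fact (m : ℤ) : ℕ := m.toNat.factorial

/-- The `n`-point function
`F_n = ∑ ⟨T_{k_1,l_1} ⊙ ⋯ ⊙ T_{k_n,l_n}⟩_q ∏_i u_i^{k_i} v_i^{l_i-1} / (k_i! (l_i-1)!)`,
the sum being over all integers `k_i`, `l_i` with `k_i + l_i` even; the monomial with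
exponent `e` belongs to `k_i = e(u_i)`, `l_i = e(v_i) + 1`. -/
def F (n : ℕ) : Laurent (Vars n) where
  coeff e :=
    open Classical in
    if ∀ i, Even (e (.inl i) + (e (.inr i) + 1)) then
      (∏ i, ((fact (e (.inl i)) * fact (e (.inr i)) : ℕ) : ℚ))⁻¹ •
        bracket (inducedProd fun i => T (e (.inl i)) (e (.inr i) + 1))
    else 0
  isPWO_support' := by
    refine isPWO_of_bddBelow _ ?_
    intro e he
    by_contra! hcon
    obtain ⟨s, hs⟩ := hcon
    apply he
    obtain ⟨i, hi⟩ : ∃ i : Fin n, T (e (.inl i)) (e (.inr i) + 1) = 0 := by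
      rcases s with i | i
      · exact ⟨i, T_eq_zero (Or.inl hs)⟩
      · exact ⟨i, T_eq_zero (Or.inr (by omega))⟩
    have h0 := inducedProd_eq_zero (fun i => T (e (.inl i)) (e (.inr i) + 1)) i hi
    simp [h0, bracket, qBracket_zero]

/-- The variables `u_i, v_i` among `u_1, …, u_n, v_1, …, v_n`. -/
def pair {n : ℕ} (i : Fin n) : Vars 1 ↪ Vars n where
  toFun := Sum.map (fun _ => i) (fun _ => i)
  inj' := by
    rintro (a | a) (b | b) h <;> simp_all [Subsingleton.elim a b]

/-! ## The Jacobi theta series -/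

/-- The coefficient of `z^j` in `θ(z) = ∑_{ν ∈ ℤ + 1/2} (-1)^⌊ν⌋ e^{ν z} q^{ν²/2}`, as a family
indexed by the integer `n` with `ν = n + 1/2`. -/
def thetaFamily (j : ℕ) : HahnSeries.SummableFamily ℚ ℚ ℤ where
  toFun n :=
    let ν : ℚ := n + 1 / 2
    HahnSeries.single (ν ^ 2 / 2)
      ((-1) ^ ⌊ν⌋ * PowerSeries.coeff j (PowerSeries.rescale ν (PowerSeries.exp ℚ)))
  isPWO_iUnion_support' := by
    have h : ((fun N : ℕ => (N : ℚ) / 2 + 1 / 8) '' Set.univ).IsPWO := by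
      refine Set.IsPWO.image_of_monotone (Set.isPWO_of_wellQuasiOrderedLE _) ?_
      intro a b hab
      have : (a : ℚ) ≤ b := by exact_mod_cast hab
      dsimp only
      linarith
    refine h.mono ?_
    intro x hx
    obtain ⟨n, hn⟩ := Set.mem_iUnion.1 hx
    have hx' := HahnSeries.support_single_subset hn
    rw [Set.mem_singleton_iff] at hx'
    refine ⟨(n * (n + 1)).toNat, trivial, ?_⟩
    have hnn : 0 ≤ n * (n + 1) := by
      rcases le_or_gt 0 n with h | h
      · positivity
      · nlinarith
    have hc : (((n * (n + 1)).toNat : ℕ) : ℚ) = (n : ℚ) * (n + 1) := by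
      have : (((n * (n + 1)).toNat : ℕ) : ℤ) = n * (n + 1) := Int.toNat_of_nonneg hnn
      exact_mod_cast congrArg (Int.cast : ℤ → ℚ) this
    rw [hx']
    simp only [hc]
    ring
  finite_co_support' := by
    intro g
    by_cases hg : ∃ n : ℤ, ((n : ℚ) + 1 / 2) ^ 2 / 2 = g
    · obtain ⟨n, rfl⟩ := hg
      refine (Set.toFinite ({n, -1 - n} : Set ℤ)).subset ?_
      intro m hm
      have h : ((n : ℚ) + 1 / 2) ^ 2 / 2 = ((m : ℚ) + 1 / 2) ^ 2 / 2 := by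
        by_contra hne
        exact hm (HahnSeries.coeff_single_of_ne hne)
      have h2 : ((m : ℚ) - n) * (m + n + 1) = 0 := by linarith
      have h3 : (m - n) * (m + n + 1) = 0 := by exact_mod_cast h2
      rcases mul_eq_zero.1 h3 with h4 | h4
      · left; omega
      · right
        rw [Set.mem_singleton_iff]
        omega
    · convert Set.finite_empty
      ext m
      simp only [Set.mem_ofPred_eq, Set.mem_empty_iff_false, iff_false, not_not]
      exact HahnSeries.coeff_single_of_ne fun h => hg ⟨m, h.symm⟩

/-- The Jacobi theta series `θ(z) = ∑_{ν ∈ ℤ + 1/2} (-1)^⌊ν⌋ e^{ν z} q^{ν²/2}`, as a power series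
in `z` with coefficients in `K`. -/
def theta : PowerSeries K := PowerSeries.mk fun j => (thetaFamily j).hsum

/-- `θ'(0)`. -/
def thetaDerivZero : K := PowerSeries.constantCoeff (PowerSeries.derivative K theta)

/-- The variable `u` of the one-point function. -/
def u : MvPowerSeries (Vars 1) K := MvPowerSeries.X (.inl 0)
/-- The variable `v` of the one-point function. -/
def v : MvPowerSeries (Vars 1) K := MvPowerSeries.X (.inr 0)

/-- `θ(w)` for a power series `w` in `u, v` without constant term, as a Laurent series. -/
def thetaAt (w : MvPowerSeries (Vars 1) K) : Laurent (Vars 1) :=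
  ofMvPowerSeries (Vars 1) (PowerSeries.subst w theta)

/-! ## The partition function -/

/-- The index set `k ≥ 0`, `l ≥ 1`, `k + l` even. -/
abbrev Idx : Type := {p : ℕ × ℕ // 1 ≤ p.2 ∧ Even (p.1 + p.2)}

/-- The partition function
`Φ(t) = ∑_n (1/n!) ∑_{k,l} ⟨T_{k_1,l_1} ⊙ ⋯ ⊙ T_{k_n,l_n}⟩_q t_{k_1,l_1} ⋯ t_{k_n,l_n}`,
a power series in the variables `t_{k,l}`. Only `n = deg m` and the finitely many tuples `p` of
indices with `t_{p_1} ⋯ t_{p_n} = t^m` contribute to the coefficient of a monomial `t^m`. -/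
def Phi : MvPowerSeries Idx K := fun m =>
  open Classical in
  ((m.degree.factorial : ℚ)⁻¹) •
    ∑ p ∈ (Fintype.piFinset fun _ : Fin m.degree => m.support).filter
        (fun p => ∑ i, Finsupp.single (p i) 1 = m),
      bracket (inducedProd fun i => T (p i).1.1 (p i).1.2)

/-- Polynomials in `x = X 0` and `y = X 1`. -/
abbrev Poly : Type := MvPolynomial (Fin 2) K

/-- Formal integration with respect to the `i`-th variable, without constant of integration:
a monomial is multiplied by the variable `X i` and divided by its new exponent. It is a right
inverse of `∂/∂X_i`. -/
def integ (i : Fin 2) : Poly →ₗ[K] Poly :=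
  (MvPolynomial.basisMonomials (Fin 2) K).constr K fun e =>
    MvPolynomial.monomial (e + Finsupp.single i 1) (((e i : K) + 1)⁻¹)

/-- The integral powers of `∂/∂X_i`; `(∂/∂X_i)^{-1}` is formal integration. -/
def dpow (i : Fin 2) : ℤ → (Poly →ₗ[K] Poly)
  | Int.ofNat a => (MvPolynomial.pderiv i).toLinearMap ^ a
  | Int.negSucc a => integ i ^ (a + 1)

/-- The operator `G(∂/∂x, ∂/∂y)`, for a Laurent series `G` in two variables, acting on a
polynomial in `x, y`; the sum has only finitely many non-zero terms. -/
def diffOp (G : Laurent (Vars 1)) (f : Poly) : Poly :=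
  ∑ᶠ e : Vars 1 → ℤ, G.coeff e • dpow 0 (e (.inl 0)) (dpow 1 (e (.inr 0)) f)

/-- `∑_{k,l} t_{k,l} x^k y^{l-1}`, as a power series in the variables `t_{k,l}` with
coefficients in the polynomials in `x, y`. -/
def tSeries : MvPowerSeries Idx Poly := fun m =>
  open Classical in
  ∑ p ∈ m.support, if m = Finsupp.single p 1 then
    MvPolynomial.X 0 ^ p.1.1 * MvPolynomial.X 1 ^ (p.1.2 - 1) else 0

/-- `[x^0 y^0] F_1(∂/∂x, ∂/∂y) ∑_{k,l} t_{k,l} x^k y^{l-1}`, where the operator and `[x^0 y^0]`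
act on the coefficients of the monomials in the `t_{k,l}`. -/
def exponentSeries : MvPowerSeries Idx K := fun m =>
  MvPolynomial.constantCoeff (diffOp (F 1) (MvPowerSeries.coeff m tSeries))

end PartitionBracket

end

/-! The `q`-bracket is the `u`-bracket at `u_m = q^m`, so it turns `⊙` into ordinary multiplication
(`qBracket_inducedMul`). This reduces everything to one factor: `F_n` is a product of copies of
`F_1` in disjoint variables (`F_eq_prod`), and `Φ` is the exponential of its linear part `∑
⟨T_{k,l}⟩_q t_{k,l}` (`Phi_eq`). The operator in the exponent only extracts that linear part: `∂_x^a
∂_y^b x^k y^(l-1)` has constant term `k! (l-1)!` if `(a, b) = (k, l-1)` and `0` otherwise.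

For `F_1`, the partitions of `n` with `r_m ≥ i` correspond to the partitions of `n - m i`, so the
non-constant part of `⟨T_{k,l}⟩_q` is `∑ m^k i^(l-1) q^(m i)` (`qGen_moment`). The Bernoulli
constants and the exceptional values `-1/2` supply the hyperbolic cotangents (`coeff_numer`): `2 F_1
= -½ coth(u/2) - ½ coth(v/2) + ∑_{m,n ≥ 1} q^(mn) (e^(mu+nv) - e^(-mu-nv))`. In `x = e^u`, `y = e^v`
this is formally Kronecker's series `∑_{m,n ≥ 0} q^(mn) x^m y^n - ∑_{m,n < 0} q^(mn) x^m y^n`, whose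
coefficients are `ker`.

It remains to see that `θ(u) θ(v)` times this series is `-θ'(0) θ(u+v)`. The coefficients `conv a b`
of the product satisfy `conv (a+1) (b+1) = -q^(b+1) conv a b`, because the kernel and the theta
coefficients have matching shifts and `θ(0) = 0` (`conv_succ`). By symmetry `q^(a+1)` may replace
`q^(b+1)`, so `conv` vanishes off the diagonal; on the diagonal it is proportional to the theta
coefficients, with factor `conv 0 0 = -θ'(0)` up to a power of `q` (`conv_eq`).

The terms of `ker` with `m n = 0` have no formal sum in powers of `u` and `v`. The argument is
therefore run after multiplication by `(1 - x)(1 - y)`, that is, on second differences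
(`jacU_mul_jacV_mul`), and this factor is cancelled at the end. -/

noncomputable section

namespace PartitionBracket

/-! ## Multiplicativity of the `q`-bracket -/

/-- The size of the partition with multiplicities `e`. -/
def weight (e : ℕ+ →₀ ℕ) : ℕ := ((Finsupp.toMultiset e).map PNat.val).sum

theorem weight_add (a b : ℕ+ →₀ ℕ) : weight (a + b) = weight a + weight b := by
  simp [weight]

theorem weight_exponent (lam : Ptn) : weight (exponent lam) = lam.1 :=
  congrArg Sigma.fst (ofExponent_exponent lam)

theorem exponent_injective : Function.Injective exponent :=
  Function.LeftInverse.injective ofExponent_exponent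

/-- The multiplicity vectors of the partitions of `n`. -/
def exponents (n : ℕ) : Finset (ℕ+ →₀ ℕ) :=
  open Classical in Finset.univ.image fun lam : n.Partition => exponent ⟨n, lam⟩

theorem mem_exponents {n : ℕ} {e : ℕ+ →₀ ℕ} : e ∈ exponents n ↔ weight e = n := by
  classical
  simp only [exponents, Finset.mem_image, Finset.mem_univ, true_and]
  constructor
  · rintro ⟨lam, rfl⟩
    exact weight_exponent _
  · rintro rfl
    exact ⟨(ofExponent e).2, exponent_ofExponent e⟩

/-- The specialization `u_m = q^m`. -/
def specialize (G : MvPowerSeries ℕ+ ℚ) : PowerSeries ℚ :=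
  PowerSeries.mk fun n => ∑ e ∈ exponents n, MvPowerSeries.coeff e G

theorem specialize_uGen (f : Ptn → ℚ) : specialize (uGen f) = qGen f := by
  classical
  ext n
  rw [specialize, qGen, PowerSeries.coeff_mk, PowerSeries.coeff_mk, exponents,
    Finset.sum_image]
  · refine Finset.sum_congr rfl fun lam _ => ?_
    change f (ofExponent (exponent ⟨n, lam⟩)) = _
    rw [ofExponent_exponent]
  · intro a _ b _ h
    simpa using exponent_injective h

/-- The weight is additive, so the pairs `(a, b)` with `weight (a + b) = n` can be sorted by
`(weight a, weight b)`; all sums are finite because each weight occurs finitely often. -/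
theorem specialize_mul (G H : MvPowerSeries ℕ+ ℚ) :
    specialize (G * H) = specialize G * specialize H := by
  classical
  ext n
  rw [PowerSeries.coeff_mul]
  simp only [specialize, PowerSeries.coeff_mk, MvPowerSeries.coeff_mul, Finset.sum_mul_sum,
    ← Finset.sum_product', Finset.sum_sigma']
  refine Finset.sum_nbij' (fun p => ⟨(weight p.2.1, weight p.2.2), p.2⟩)
    (fun p => ⟨p.2.1 + p.2.2, p.2⟩) ?_ ?_ ?_ ?_ ?_
  · rintro ⟨e, a, b⟩ h
    simp only [Finset.mem_sigma, Finset.HasAntidiagonal.mem_antidiagonal, Finset.mem_product,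
      mem_exponents] at h ⊢
    exact ⟨by rw [← weight_add, h.2, h.1], trivial, trivial⟩
  · rintro ⟨⟨i, j⟩, a, b⟩ h
    simp only [Finset.mem_sigma, Finset.HasAntidiagonal.mem_antidiagonal, Finset.mem_product,
      mem_exponents] at h ⊢
    exact ⟨by rw [weight_add, h.2.1, h.2.2, h.1], trivial⟩
  · rintro ⟨e, a, b⟩ h
    simp only [Finset.mem_sigma, Finset.HasAntidiagonal.mem_antidiagonal] at h
    simp [h.2]
  · rintro ⟨⟨i, j⟩, a, b⟩ h
    simp only [Finset.mem_sigma, Finset.mem_product, mem_exponents] at h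
    simp [h.2.1, h.2.2]
  · intros; rfl

theorem uBracket_mul_uGen_one (f : Ptn → ℚ) : uBracket f * uGen 1 = uGen f := by
  rw [uBracket, mul_assoc, MvPowerSeries.inv_mul_cancel _ constantCoeff_uGen_one, mul_one]

theorem constantCoeff_qGen_one : PowerSeries.constantCoeff (qGen 1) ≠ (0 : ℚ) := by
  rw [← PowerSeries.coeff_zero_eq_constantCoeff_apply]
  simp [qGen]

theorem qBracket_mul_qGen_one (f : Ptn → ℚ) : qBracket f * qGen 1 = qGen f := by
  rw [qBracket, mul_assoc, PowerSeries.inv_mul_cancel _ constantCoeff_qGen_one, mul_one]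

theorem qGen_one_ne_zero : qGen 1 ≠ 0 := by
  intro h
  exact constantCoeff_qGen_one (by rw [h, map_zero])

/-- Specialization is applied to the defining identity with denominators cleared, so that no inverse
has to be specialized. -/
theorem qBracket_inducedMul (f g : Ptn → ℚ) :
    qBracket (inducedMul f g) = qBracket f * qBracket g := by
  have h : uGen (inducedMul f g) * uGen 1 = uGen f * uGen g := by
    rw [← uBracket_mul_uGen_one (inducedMul f g), uBracket_inducedMul,
      ← uBracket_mul_uGen_one f, ← uBracket_mul_uGen_one g]
    ring
  have h' := congrArg specialize h
  simp only [specialize_mul, specialize_uGen, ← qBracket_mul_qGen_one (inducedMul f g),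
    ← qBracket_mul_qGen_one f, ← qBracket_mul_qGen_one g] at h'
  refine mul_right_cancel₀ (mul_ne_zero qGen_one_ne_zero qGen_one_ne_zero) ?_
  linear_combination h'

theorem bracket_inducedMul (f g : Ptn → ℚ) :
    bracket (inducedMul f g) = bracket f * bracket g := by
  rw [bracket, qBracket_inducedMul, map_mul]; rfl

theorem bracket_one : bracket 1 = 1 := by
  rw [bracket, qBracket, PowerSeries.mul_inv_cancel _ constantCoeff_qGen_one, map_one]

theorem bracket_inducedProd {n : ℕ} (f : Fin n → Ptn → ℚ) :
    bracket (inducedProd f) = ∏ i, bracket (f i) := by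
  rw [← List.prod_ofFn, inducedProd]
  have key : ∀ L : List (Ptn → ℚ), bracket (L.foldr inducedMul 1) = (L.map bracket).prod := by
    intro L
    induction L with
    | nil => simp [bracket_one]
    | cons a L ih => simp [bracket_inducedMul, ih]
  rw [key, List.map_ofFn]
  rfl

/-! ## Products of Laurent series in disjoint sets of variables -/

theorem rename_coeff {σ τ : Type} (i : σ ↪ τ) (A : Laurent σ) (e : τ → ℤ)
    (he : ∀ t, t ∉ Set.range i → e t = 0) : (rename i A).coeff e = A.coeff (e ∘ i) := by
  have h : e = Function.extend i (e ∘ i) 0 := by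
    funext t
    by_cases ht : ∃ s, i s = t
    · obtain ⟨s, rfl⟩ := ht
      simp [i.injective.extend_apply]
    · simpa [Function.extend_apply' _ _ _ ht] using he t ht
  conv_lhs => rw [h]
  exact HahnSeries.embDomain_coeff (f := ⟨⟨_, _⟩, _⟩)

theorem rename_coeff_eq_zero {σ τ : Type} (i : σ ↪ τ) (A : Laurent σ) (e : τ → ℤ) (t : τ)
    (ht : t ∉ Set.range i) (he : e t ≠ 0) : (rename i A).coeff e = 0 := by
  refine HahnSeries.embDomain_of_notMem_range (f := ⟨⟨_, _⟩, _⟩) ?_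
  rintro ⟨a, rfl⟩
  apply he
  exact Function.extend_apply' _ _ _ ht

theorem range_pair {n : ℕ} (i : Fin n) (t : Vars n) :
    t ∈ Set.range (pair i) ↔ Sum.elim id id t = i := by
  rcases t with t | t
  · simp only [Sum.elim_inl, id]
    constructor
    · rintro ⟨a | a, h⟩ <;> cases h <;> rfl
    · rintro rfl; exact ⟨.inl 0, rfl⟩
  · simp only [Sum.elim_inr, id]
    constructor
    · rintro ⟨a | a, h⟩ <;> cases h <;> rfl
    · rintro rfl; exact ⟨.inr 0, rfl⟩

/-- Discard the exponents of the variables whose index is not in `s`. -/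
def cut {n : ℕ} (s : Finset (Fin n)) (e : Vars n → ℤ) : Vars n → ℤ := fun t =>
  if Sum.elim id id t ∈ s then e t else 0

/-- Factors in disjoint variables do not interact: an exponent splits in at most one way into
exponents of the factors, and in no way if it involves a variable with index outside `s`, which is
what `cut s e = e` excludes. -/
theorem prod_rename_pair_coeff {n : ℕ} (A : Fin n → Laurent (Vars 1)) (s : Finset (Fin n))
    (e : Vars n → ℤ) : (∏ i ∈ s, rename (pair i) (A i)).coeff e =
      if cut s e = e then ∏ i ∈ s, (A i).coeff (e ∘ pair i) else 0 := by
  induction s using Finset.induction_on generalizing e with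
  | empty =>
    simp only [Finset.prod_empty]
    have h : cut ∅ e = e ↔ e = 0 := by
      constructor
      · intro h; rw [← h]; funext t; simp [cut]
      · rintro rfl; funext t; simp [cut]
    by_cases h0 : e = 0
    · rw [if_pos (h.2 h0), h0, HahnSeries.coeff_one, if_pos rfl]
    · rw [if_neg (fun h' => h0 (h.1 h')), HahnSeries.coeff_one, if_neg h0]
  | insert i s hi ih =>
    rw [Finset.prod_insert hi, Finset.prod_insert hi, HahnSeries.coeff_mul]
    -- The only splitting of `e` that can contribute to the convolution sum.
    have hsum : ∀ p : (Vars n → ℤ) × (Vars n → ℤ), p.1 + p.2 = e →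
        (rename (pair i) (A i)).coeff p.1 ≠ 0 →
        (∏ j ∈ s, rename (pair j) (A j)).coeff p.2 ≠ 0 →
        p = (cut {i} e, cut s e) ∧ cut (insert i s) e = e := by
      rintro ⟨a, b⟩ rfl h1 h2
      have ha : ∀ t, Sum.elim id id t ≠ i → a t = 0 := by
        intro t ht
        by_contra hne
        exact h1 (rename_coeff_eq_zero _ _ _ t (by rwa [range_pair]) hne)
      have hb : cut s b = b := by
        by_contra hne
        exact h2 (by rw [ih, if_neg hne])
      have hb' : ∀ t, Sum.elim id id t ∉ s → b t = 0 := by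
        intro t ht
        rw [← hb]
        simp [cut, ht]
      refine ⟨Prod.ext ?_ ?_, ?_⟩
      · funext t
        simp only [cut, Finset.mem_singleton]
        split_ifs with h
        · have := hb' t (by rw [h]; exact hi)
          simp [this]
        · exact ha t h
      · funext t
        simp only [cut]
        split_ifs with h
        · have := ha t (by rintro h'; exact hi (h' ▸ h))
          simp [this]
        · exact hb' t h
      · funext t
        simp only [cut, Finset.mem_insert]
        split_ifs with h
        · rfl
        · push Not at h
          simp [ha t h.1, hb' t h.2]
    split_ifs with hcut
    · have hadd : cut {i} e + cut s e = e := by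
        funext t
        conv_rhs => rw [← hcut]
        simp only [cut, Pi.add_apply, Finset.mem_singleton, Finset.mem_insert]
        by_cases h1 : Sum.elim id id t = i
        · simp [h1, hi]
        · simp [h1]
      have hL : (rename (pair i) (A i)).coeff (cut {i} e) = (A i).coeff (e ∘ pair i) := by
        rw [rename_coeff]
        · congr 1
          funext t
          have : pair i t ∈ Set.range (pair i) := ⟨t, rfl⟩
          rw [range_pair] at this
          simp [cut, this]
        · intro t ht
          rw [range_pair] at ht
          simp [cut, ht]
      have hR : (∏ j ∈ s, rename (pair j) (A j)).coeff (cut s e) =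
          ∏ j ∈ s, (A j).coeff (e ∘ pair j) := by
        rw [ih, if_pos (by funext t; simp only [cut]; split_ifs <;> rfl)]
        refine Finset.prod_congr rfl fun j hj => ?_
        congr 1
        funext t
        have : pair j t ∈ Set.range (pair j) := ⟨t, rfl⟩
        rw [range_pair] at this
        simp [cut, this, hj]
      rw [← hL, ← hR]
      refine Finset.sum_eq_single (cut {i} e, cut s e) ?_ ?_
      · intro p hp hne
        rw [Finset.mem_antidiagonal] at hp
        exact absurd (hsum p hp.2.2 hp.1 hp.2.1).1 hne
      · intro h
        rw [Finset.mem_antidiagonal] at h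
        by_contra hne
        exact h ⟨left_ne_zero_of_mul hne, right_ne_zero_of_mul hne, hadd⟩
    · refine Finset.sum_eq_zero fun p hp => ?_
      rw [Finset.mem_antidiagonal] at hp
      exact absurd (hsum p hp.2.2 hp.1 hp.2.1).2 hcut

theorem F_one_coeff (e : Vars 1 → ℤ) : (F 1).coeff e =
    if Even (e (.inl 0) + (e (.inr 0) + 1)) then
      ((fact (e (.inl 0)) * fact (e (.inr 0)) : ℕ) : ℚ)⁻¹ •
        bracket (T (e (.inl 0)) (e (.inr 0) + 1))
    else 0 := by
  classical
  simp only [F, Fin.forall_fin_one, Fin.prod_univ_one, bracket_inducedProd]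

theorem F_eq_prod (n : ℕ) : F n = ∏ i : Fin n, rename (pair i) (F 1) := by
  classical
  ext1
  funext e
  rw [prod_rename_pair_coeff, if_pos (by funext t; simp [cut])]
  simp only [F_one_coeff]
  simp only [F, bracket_inducedProd]
  have h1 : ∀ i : Fin n, (e ∘ pair i) (.inl 0) = e (.inl i) := fun i => rfl
  have h2 : ∀ i : Fin n, (e ∘ pair i) (.inr 0) = e (.inr i) := fun i => rfl
  simp only [h1, h2]
  split_ifs with h
  · rw [← Finset.prod_inv_distrib, ← Finset.prod_smul]
    exact Finset.prod_congr rfl fun i _ => by rw [if_pos (h i)]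
  · push Not at h
    obtain ⟨i, hi⟩ := h
    exact (Finset.prod_eq_zero (Finset.mem_univ i) (if_neg hi)).symm

/-! ## The partition function -/

theorem integ_monomial (i : Fin 2) (s : Fin 2 →₀ ℕ) (c : K) :
    integ i (MvPolynomial.monomial s c) =
      MvPolynomial.monomial (s + Finsupp.single i 1) (c * ((s i : K) + 1)⁻¹) := by
  have h : MvPolynomial.monomial s c = c • MvPolynomial.basisMonomials (Fin 2) K s := by
    simp [MvPolynomial.smul_monomial]
  rw [h, map_smul, integ, Module.Basis.constr_basis, MvPolynomial.smul_monomial, smul_eq_mul]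

theorem pderiv_pow_monomial (i : Fin 2) (a : ℕ) (s : Fin 2 →₀ ℕ) (c : K) :
    ((MvPolynomial.pderiv i).toLinearMap ^ a) (MvPolynomial.monomial s c) =
      MvPolynomial.monomial (s - Finsupp.single i a) (c * ((s i).descFactorial a : K)) := by
  induction a with
  | zero => simp
  | succ a ih =>
    rw [pow_succ', Module.End.mul_apply, ih]
    change MvPolynomial.pderiv i _ = _
    rw [MvPolynomial.pderiv_monomial, tsub_tsub, ← Finsupp.single_add, mul_assoc, ← Nat.cast_mul,
      Nat.descFactorial_succ, Finsupp.tsub_apply, Finsupp.single_eq_same, mul_comm (_ - _)]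

theorem integ_pow_monomial (i : Fin 2) (a : ℕ) (s : Fin 2 →₀ ℕ) (c : K) :
    ∃ d, (integ i ^ a) (MvPolynomial.monomial s c) =
      MvPolynomial.monomial (s + Finsupp.single i a) d := by
  induction a with
  | zero => exact ⟨c, by simp⟩
  | succ a ih =>
    obtain ⟨d, hd⟩ := ih
    refine ⟨d * (((s + Finsupp.single i a) i : K) + 1)⁻¹, ?_⟩
    rw [pow_succ', Module.End.mul_apply, hd, integ_monomial, add_assoc, ← Finsupp.single_add]

/-- Treats differentiation and integration together. The coefficient is recorded only where it
matters: if the order is below the exponent, or negative, the variable survives and the constant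
term is zero whatever the coefficient. -/
theorem dpow_monomial (i : Fin 2) (z : ℤ) (s : Fin 2 →₀ ℕ) (c : K) :
    ∃ s' d, dpow i z (MvPolynomial.monomial s c) = MvPolynomial.monomial s' d ∧
      (∀ j, j ≠ i → s' j = s j) ∧ (s i < z → d = 0) ∧ (z < s i → s' i ≠ 0) ∧
      (z = s i → d = c * ((s i).factorial : K) ∧ s' i = 0) := by
  rcases z with a | a
  · refine ⟨_, _, pderiv_pow_monomial i a s c, ?_, ?_, ?_, ?_⟩
    · intro j hj
      simp [hj.symm]
    · intro h
      rw [Nat.descFactorial_of_lt (by rw [Int.ofNat_eq_natCast] at h; exact_mod_cast h), Nat.cast_zero, mul_zero]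
    · intro h
      have : a < s i := by rw [Int.ofNat_eq_natCast] at h; exact_mod_cast h
      simp only [Finsupp.tsub_apply, Finsupp.single_eq_same]
      omega
    · intro h
      have : a = s i := by rw [Int.ofNat_eq_natCast] at h; exact_mod_cast h
      simp [this, Nat.descFactorial_self]
  · obtain ⟨d, hd⟩ := integ_pow_monomial i (a + 1) s c
    refine ⟨_, d, hd, ?_, ?_, ?_, ?_⟩
    · intro j hj
      simp [hj.symm]
    · intro h; omega
    · intro h; simp
    · intro h; omega

theorem dpow_dpow_eq_zero (a b : ℤ) (s : Fin 2 →₀ ℕ) (c : K) (h : s 0 < a ∨ s 1 < b) :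
    dpow 0 a (dpow 1 b (MvPolynomial.monomial s c)) = 0 := by
  obtain ⟨s', d, h1, h2, h3, -, -⟩ := dpow_monomial 1 b s c
  obtain ⟨s'', d', h1', -, h3', -, -⟩ := dpow_monomial 0 a s' d
  rw [h1]
  rcases h with h | h
  · rw [h1', h3' (by rwa [h2 0 (by simp)]), MvPolynomial.monomial_zero]
  · rw [h3 h, MvPolynomial.monomial_zero, map_zero]

theorem constantCoeff_dpow_dpow (a b : ℤ) (s : Fin 2 →₀ ℕ) (c : K) :
    MvPolynomial.constantCoeff (dpow 0 a (dpow 1 b (MvPolynomial.monomial s c))) =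
      if a = s 0 ∧ b = s 1 then c * (((s 0).factorial * (s 1).factorial : ℕ) : K) else 0 := by
  by_cases h : s 0 < a ∨ s 1 < b
  · rw [dpow_dpow_eq_zero a b s c h, map_zero, if_neg (by omega)]
  obtain ⟨s', d, h1, h2, h3, h4, h5⟩ := dpow_monomial 1 b s c
  obtain ⟨s'', d', h1', h2', h3', h4', h5'⟩ := dpow_monomial 0 a s' d
  rw [h1, h1']
  have e0 : s' 0 = s 0 := h2 0 (by simp)
  have e1 : s'' 1 = s' 1 := h2' 1 (by simp)
  rw [MvPolynomial.constantCoeff_monomial]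
  split_ifs with h6 h7 h7
  · rw [(h5' (by rw [e0]; exact h7.1)).1, (h5 h7.2).1, e0]
    push_cast
    ring
  · exfalso
    have h60 : s'' 0 = 0 := by rw [h6]; rfl
    have h61 : s' 1 = 0 := by rw [← e1, h6]; rfl
    by_cases ha : a < s' 0
    · exact h4' ha h60
    · by_cases hb : b < s 1
      · exact h4 hb h61
      · omega
  · exfalso
    apply h6
    ext j
    fin_cases j
    · exact (h5' (by rw [e0]; exact h7.1)).2
    · exact e1.trans (h5 h7.2).2
  · rfl

theorem F_one_coeff_eq_zero (e : Vars 1 → ℤ) (s : Vars 1) (h : e s < -1) : (F 1).coeff e = 0 := by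
  have hT : T (e (.inl 0)) (e (.inr 0) + 1) = 0 := by
    rcases s with i | i
    · rw [Subsingleton.elim i 0] at h
      exact T_eq_zero (Or.inl h)
    · rw [Subsingleton.elim i 0] at h
      exact T_eq_zero (Or.inr (by omega))
  rw [F_one_coeff, hT]
  simp [bracket, qBracket_zero]

theorem constantCoeff_diffOp_monomial (s : Fin 2 →₀ ℕ) :
    MvPolynomial.constantCoeff (diffOp (F 1) (MvPolynomial.monomial s 1)) =
      (F 1).coeff (Sum.elim (fun _ => (s 0 : ℤ)) (fun _ => (s 1 : ℤ))) *
        (((s 0).factorial * (s 1).factorial : ℕ) : K) := by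
  set e₀ : Vars 1 → ℤ := Sum.elim (fun _ => (s 0 : ℤ)) (fun _ => (s 1 : ℤ)) with he₀
  -- Finiteness is needed for the `finsum` to commute with linear maps. Below `-1` the coefficients
  -- of `F 1` vanish; above `e₀` the derivative of the monomial vanishes.
  have hfin : (Function.support fun e : Vars 1 → ℤ => (F 1).coeff e •
      dpow 0 (e (.inl 0)) (dpow 1 (e (.inr 0)) (MvPolynomial.monomial s (1 : K)))).Finite := by
    refine (Set.finite_Icc (fun _ => -1 : Vars 1 → ℤ) e₀).subset fun e he => ?_
    rw [Function.mem_support] at he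
    constructor
    · intro t
      by_contra hlt
      exact he (by rw [F_one_coeff_eq_zero e t (by simpa using hlt), zero_smul])
    · intro t
      by_contra hlt
      apply he
      rw [dpow_dpow_eq_zero, smul_zero]
      rcases t with i | i
      · rw [Subsingleton.elim i 0] at hlt
        left; simpa [he₀] using hlt
      · rw [Subsingleton.elim i 0] at hlt
        right; simpa [he₀] using hlt
  have hcc : ∀ p : Poly, MvPolynomial.constantCoeff p = MvPolynomial.lcoeff K 0 p := fun _ => rfl
  rw [diffOp, hcc, map_finsum _ hfin, finsum_eq_single _ e₀]
  · rw [map_smul, ← hcc, constantCoeff_dpow_dpow, if_pos ⟨rfl, rfl⟩, one_mul, smul_eq_mul]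
  · intro e he
    rw [map_smul, ← hcc, constantCoeff_dpow_dpow, if_neg, smul_zero]
    rintro ⟨h1, h2⟩
    apply he
    funext t
    rcases t with i | i
    · rw [Subsingleton.elim i 0]; exact h1
    · rw [Subsingleton.elim i 0]; exact h2

theorem diffOp_zero (G : Laurent (Vars 1)) : diffOp G 0 = 0 := by
  simp [diffOp]

/-- The factorials produced by differentiating `x^k y^(l-1)` cancel those in the normalization of `F
1`. -/
theorem exponentSeries_single (p : Idx) :
    MvPowerSeries.coeff (Finsupp.single p 1) exponentSeries = bracket (T p.1.1 p.1.2) := by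
  classical
  have h1 : MvPowerSeries.coeff (Finsupp.single p 1) tSeries = MvPolynomial.monomial
      (Finsupp.single 0 p.1.1 + Finsupp.single 1 (p.1.2 - 1)) (1 : K) := by
    change ∑ p' ∈ (Finsupp.single p 1).support, _ = _
    have hs : (Finsupp.single p 1).support = {p} := by
      ext p'
      simp [eq_comm]
    rw [hs, Finset.sum_singleton, if_pos rfl,
      MvPolynomial.X_pow_eq_monomial, MvPolynomial.X_pow_eq_monomial,
      MvPolynomial.monomial_mul, one_mul]
  change MvPolynomial.constantCoeff (diffOp (F 1) (MvPowerSeries.coeff _ tSeries)) = _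
  obtain ⟨⟨k, l⟩, hl, heven⟩ := p
  rw [h1, constantCoeff_diffOp_monomial, F_one_coeff]
  have hl' : ((l - 1 : ℕ) : ℤ) = l - 1 := by
    have : 1 ≤ l := hl
    omega
  have hev : Even ((k : ℤ) + l) := by exact_mod_cast heven
  simp only [Finsupp.coe_add, Pi.add_apply, Finsupp.single_eq_same, Sum.elim_inl, Sum.elim_inr,
    Finsupp.single_eq_of_ne (zero_ne_one' (Fin 2)),
    Finsupp.single_eq_of_ne (zero_ne_one' (Fin 2)).symm, add_zero, zero_add, fact,
    Int.toNat_natCast]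
  rw [hl', sub_add_cancel, if_pos hev]
  have hne : ((k.factorial * (l - 1).factorial : ℕ) : ℚ) ≠ 0 := by
    exact_mod_cast (Nat.mul_pos k.factorial_pos (l - 1).factorial_pos).ne'
  have hcast : ((k.factorial * (l - 1).factorial : ℕ) : K) =
      ((k.factorial * (l - 1).factorial : ℕ) : ℚ) • (1 : K) := by
    rw [Nat.cast_smul_eq_nsmul, nsmul_eq_mul, mul_one]
  rw [hcast, mul_smul_comm, mul_one, smul_smul, mul_inv_cancel₀ hne, one_smul]

theorem exponentSeries_eq_zero (m : Idx →₀ ℕ) (hm : ∀ p, m ≠ Finsupp.single p 1) :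
    MvPowerSeries.coeff m exponentSeries = 0 := by
  classical
  have h : MvPowerSeries.coeff m tSeries = 0 := Finset.sum_eq_zero fun p _ => if_neg (hm p)
  change MvPolynomial.constantCoeff (diffOp (F 1) (MvPowerSeries.coeff m tSeries)) = _
  rw [h, diffOp_zero, map_zero]

/-- Since `exponentSeries` has only linear monomials, the nonzero terms of its `d`-th power are
indexed by `d`-tuples of variables, exactly as in the definition of `Phi`. -/
theorem exponentSeries_pow_coeff (d : ℕ) (m : Idx →₀ ℕ) [DecidableEq Idx] :
    MvPowerSeries.coeff m (exponentSeries ^ d) =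
      ∑ p ∈ (Fintype.piFinset fun _ : Fin d => m.support).filter
        (fun p => ∑ i, Finsupp.single (p i) 1 = m), ∏ i, bracket (T (p i).1.1 (p i).1.2) := by
  classical
  have h : exponentSeries ^ d = ∏ _i : Fin d, exponentSeries := by simp
  rw [h, MvPowerSeries.coeff_prod]
  symm
  refine Finset.sum_of_injOn
    (fun p : Fin d → Idx => Finsupp.equivFunOnFinite.symm fun i => Finsupp.single (p i) 1)
    ?_ ?_ ?_ ?_
  · intro p _ p' _ hpp
    funext i
    have := DFunLike.congr_fun hpp i
    simpa [Finsupp.single_left_inj] using this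
  · intro p hp
    simp only [Finset.coe_filter, Set.mem_ofPred_eq] at hp
    simp [Finset.mem_finsuppAntidiag, hp.2]
  · intro l hl hnot
    rw [Finset.mem_finsuppAntidiag] at hl
    by_contra hne
    have hp : ∀ i, ∃ p, l i = Finsupp.single p 1 := by
      intro i
      by_contra! hcon
      exact hne (Finset.prod_eq_zero (Finset.mem_univ i) (exponentSeries_eq_zero _ hcon))
    choose p hp using hp
    refine hnot ⟨p, ?_, ?_⟩
    · have hsum : ∑ i, Finsupp.single (p i) 1 = m := by
        rw [← hl.1]
        exact Finset.sum_congr rfl fun i _ => (hp i).symm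
      simp only [Finset.coe_filter, Set.mem_ofPred_eq, Fintype.mem_piFinset]
      refine ⟨fun i => ?_, hsum⟩
      rw [Finsupp.mem_support_iff, ← hsum, Finsupp.finsetSum_apply]
      intro h0
      rw [Finset.sum_eq_zero_iff] at h0
      simpa using h0 i (Finset.mem_univ i)
    · ext1 i
      simp [hp]
  · intro p _
    refine Finset.prod_congr rfl fun i _ => ?_
    simp [exponentSeries_single]

theorem hasSubst_exponentSeries : PowerSeries.HasSubst exponentSeries := by
  refine PowerSeries.HasSubst.of_constantCoeff_zero ?_
  rw [← MvPowerSeries.coeff_zero_eq_constantCoeff_apply]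
  refine exponentSeries_eq_zero _ fun p h => ?_
  simpa using DFunLike.congr_fun h p

theorem Phi_eq : Phi = PowerSeries.subst exponentSeries (PowerSeries.exp K) := by
  classical
  refine MvPowerSeries.ext fun m => ?_
  rw [PowerSeries.coeff_subst hasSubst_exponentSeries, finsum_eq_single _ m.degree]
  · rw [exponentSeries_pow_coeff, PowerSeries.coeff_exp]
    change ((m.degree.factorial : ℚ)⁻¹) • (_ : K) = _
    simp only [bracket_inducedProd]
    rw [one_div, smul_eq_mul, ← Algebra.smul_def]
    congr!
    -- The two scalar actions of `ℚ` on `K` come from different instances; a `ℚ`-algebra structure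
    -- is unique.
    exact congrArg (fun i : Algebra ℚ K => i.toSMul)
      (Subsingleton.elim (HahnSeries.instAlgebra : Algebra ℚ K) _)
  · intro d hd
    rw [exponentSeries_pow_coeff, Finset.filter_false_of_mem, Finset.sum_empty, smul_zero]
    rintro p - hp
    apply hd
    rw [← hp, map_sum]
    simp

open scoped PowerSeries.WithPiTopology MvPowerSeries.WithPiTopology

/-! ## Families of power series in `q` tending to zero -/

/-- A family of power series in which every power of `q` occurs only finitely often. -/
def Null {ι : Type*} (c : ι → PowerSeries ℚ) : Prop :=
  ∀ N, {i | PowerSeries.coeff N (c i) ≠ 0}.Finite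

/-- The coefficient of `q^N` in a product involves only the coefficients of `c i` up to `N`, so
arbitrary weights `w` are harmless. -/
theorem Null.mul_right {ι : Type*} {c : ι → PowerSeries ℚ} (hc : Null c)
    (w : ι → PowerSeries ℚ) : Null fun i => c i * w i := by
  intro N
  refine ((Finset.range (N + 1)).finite_toSet.biUnion fun k _ => hc k).subset fun i hi => ?_
  simp only [Set.mem_ofPred_eq, PowerSeries.coeff_mul] at hi
  obtain ⟨p, hp, hne⟩ := Finset.exists_ne_zero_of_sum_ne_zero hi
  rw [Finset.HasAntidiagonal.mem_antidiagonal] at hp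
  simp only [Set.mem_iUnion]
  exact ⟨p.1, by simp; omega, left_ne_zero_of_mul hne⟩

theorem Null.mul_prod {ι κ : Type*} {c : ι → PowerSeries ℚ} {d : κ → PowerSeries ℚ}
    (hc : Null c) (hd : Null d) : Null fun p : ι × κ => c p.1 * d p.2 := by
  intro N
  refine ((Finset.HasAntidiagonal.antidiagonal N).finite_toSet.biUnion
    fun k _ => (hc k.1).prod (hd k.2)).subset fun i hi => ?_
  simp only [Set.mem_ofPred_eq, PowerSeries.coeff_mul] at hi
  obtain ⟨p, hp, hne⟩ := Finset.exists_ne_zero_of_sum_ne_zero hi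
  simp only [Set.mem_iUnion]
  exact ⟨p, hp, left_ne_zero_of_mul hne, right_ne_zero_of_mul hne⟩

theorem Null.comp {ι κ : Type*} {c : ι → PowerSeries ℚ} (hc : Null c) {f : κ → ι}
    (hf : Function.Injective f) : Null fun k => c (f k) :=
  fun N => (hc N).preimage hf.injOn

theorem Null.add {ι : Type*} {c d : ι → PowerSeries ℚ} (hc : Null c) (hd : Null d) :
    Null fun i => c i + d i := by
  intro N
  refine ((hc N).union (hd N)).subset fun i hi => ?_
  by_contra hcon
  simp only [Set.mem_union, Set.mem_ofPred_eq, not_or, not_not] at hcon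
  exact hi (by rw [map_add, hcon.1, hcon.2, add_zero])

theorem Null.neg {ι : Type*} {c : ι → PowerSeries ℚ} (hc : Null c) : Null fun i => -c i := by
  intro N
  simpa using hc N

theorem Null.sub {ι : Type*} {c d : ι → PowerSeries ℚ} (hc : Null c) (hd : Null d) :
    Null fun i => c i - d i := by
  simpa only [sub_eq_add_neg] using hc.add hd.neg

theorem Null.summable {ι : Type*} {c : ι → PowerSeries ℚ} (hc : Null c) : Summable c := by
  rw [PowerSeries.WithPiTopology.summable_iff_summable_coeff]
  exact fun N => summable_of_hasFiniteSupport (hc N)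

theorem Null.summable_C_mul {ι σ : Type*} {c : ι → PowerSeries ℚ} (hc : Null c)
    (w : ι → MvPowerSeries σ (PowerSeries ℚ)) :
    Summable fun i => MvPowerSeries.C (c i) * w i := by
  rw [MvPowerSeries.WithPiTopology.summable_iff_summable_coeff]
  intro e
  simp only [MvPowerSeries.coeff_C_mul]
  exact (hc.mul_right _).summable

/-! ## The coefficients of the theta series -/

/-- `i (i + 1) / 2`. -/
def tri (i : ℤ) : ℕ := (i * (i + 1) / 2).toNat

theorem two_mul_tri (i : ℤ) : 2 * (tri i : ℤ) = i * (i + 1) := by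
  have h : 2 ∣ i * (i + 1) := (Int.even_mul_succ_self i).two_dvd
  have h0 : 0 ≤ i * (i + 1) := by
    rcases le_or_gt 0 i with h | h
    · positivity
    · nlinarith
  rw [tri, Int.toNat_of_nonneg (by omega)]
  omega

theorem tri_eq_iff (i j : ℤ) : tri i = tri j ↔ i = j ∨ i = -1 - j := by
  have hi := two_mul_tri i
  have hj := two_mul_tri j
  constructor
  · intro h
    rw [h, hj] at hi
    have h2 : (i - j) * (i + j + 1) = 0 := by linear_combination -hi
    rcases mul_eq_zero.1 h2 with h3 | h3
    · left; omega
    · right; omega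
  · rintro (rfl | rfl)
    · rfl
    · have : (tri (-1 - j) : ℤ) = tri j := by linarith
      exact_mod_cast this

/-- The coefficient `(-1)^i q^(i (i + 1) / 2)` of `q^(1/8) θ`. -/
def jac (i : ℤ) : PowerSeries ℚ := PowerSeries.monomial (tri i) ((-1) ^ i)

theorem coeff_jac (N : ℕ) (i : ℤ) :
    PowerSeries.coeff N (jac i) = if N = tri i then (-1) ^ i else 0 :=
  PowerSeries.coeff_monomial ..

theorem null_jac : Null jac := by
  intro N
  by_cases h : ∃ j, tri j = N
  · obtain ⟨j, rfl⟩ := h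
    refine (Set.toFinite {j, -1 - j}).subset fun i hi => ?_
    simp only [Set.mem_ofPred_eq, coeff_jac] at hi
    have h1 : tri i = tri j := by
      by_contra hne
      exact hi (if_neg (Ne.symm hne))
    simpa using (tri_eq_iff i j).1 h1
  · convert Set.finite_empty
    ext i
    simp only [Set.mem_ofPred_eq, coeff_jac, Set.mem_empty_iff_false, iff_false, not_not]
    exact if_neg fun h' => h ⟨i, h'.symm⟩

theorem jac_reflect (i : ℤ) : jac (-1 - i) = -jac i := by
  have h1 : tri (-1 - i) = tri i := (tri_eq_iff _ _).2 (Or.inr rfl)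
  have h2 : (-1 : ℚ) ^ (-1 - i) = -(-1) ^ i := by
    rw [zpow_sub₀ (by norm_num), zpow_neg_one, div_eq_mul_inv, ← inv_zpow]
    norm_num
  rw [jac, jac, h1, h2, map_neg]

/-- This is `θ(0) = 0`: the reflection `i ↦ -1 - i`, i.e. `ν ↦ -ν`, reverses the sign of each term.
-/
theorem tsum_jac : ∑' i, jac i = 0 := by
  have h : ∑' i, jac i = -∑' i, jac i := by
    rw [← tsum_neg, ← (Equiv.subLeft (-1 : ℤ)).tsum_eq jac]
    exact tsum_congr fun i => jac_reflect i
  ext N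
  have hN := congrArg (PowerSeries.coeff N) h
  rw [map_neg] at hN
  rw [map_zero]
  linarith

/-- The coefficient of `x^m y^n` in the expansion of `-(½ coth (u/2) + ½ coth (v/2) - ⋯)` for
small `x = e^u`, `y = e^v`. -/
def ker (m n : ℤ) : PowerSeries ℚ :=
  if 0 ≤ m ∧ 0 ≤ n then PowerSeries.monomial (m * n).toNat 1
  else if m < 0 ∧ n < 0 then PowerSeries.monomial (m * n).toNat (-1) else 0

theorem ker_comm (m n : ℤ) : ker m n = ker n m := by
  simp only [ker, mul_comm m n, and_comm]

/-- Combines `jac (i+1) = -q^(i+1) jac i` with `ker (m+1) n = q^n ker m n + [m = -1]`. The powers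
`q^(b+1-n)` and `q^n` multiply to `q^(b+1)`, which no longer depends on `n`. Writing `b + 1 = k - l`
avoids negative powers of `q`. -/
theorem jac_mul_ker_succ (b m n : ℤ) (k l : ℕ) (hkl : (k : ℤ) - l = b + 1) :
    PowerSeries.X ^ l * (jac (b + 1 - n) * ker (m + 1) n) =
      -(PowerSeries.X ^ k * (jac (b - n) * ker m n)) +
        if m = -1 then PowerSeries.X ^ l * jac (b + 1 - n) else 0 := by
  have h1 := two_mul_tri (b + 1 - n)
  have h2 := two_mul_tri (b - n)
  have h3 : (tri (b + 1 - n) : ℤ) = tri (b - n) + (b + 1 - n) := by linarith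
  have hs : (-1 : ℚ) ^ (b + 1 - n) = -(-1) ^ (b - n) := by
    rw [show b + 1 - n = (b - n) + 1 by ring, zpow_add_one₀ (by norm_num)]
    ring
  simp only [ker, jac, PowerSeries.X_pow_eq, hs]
  rcases lt_trichotomy m (-1) with hm | rfl | hm
  · rw [if_neg hm.ne, if_neg (show ¬(0 ≤ m + 1 ∧ 0 ≤ n) by omega),
      if_neg (show ¬(0 ≤ m ∧ 0 ≤ n) by omega)]
    by_cases hn : n < 0
    · rw [if_pos (show m + 1 < 0 ∧ n < 0 by omega), if_pos (show m < 0 ∧ n < 0 by omega)]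
      simp only [PowerSeries.monomial_mul_monomial]
      have e1 := Int.toNat_of_nonneg (mul_nonneg_of_nonpos_of_nonpos (show m + 1 ≤ 0 by omega) hn.le)
      have e2 := Int.toNat_of_nonneg (mul_nonneg_of_nonpos_of_nonpos (show m ≤ 0 by omega) hn.le)
      have : l + (tri (b + 1 - n) + ((m + 1) * n).toNat) =
          k + (tri (b - n) + (m * n).toNat) := by
        zify
        rw [e1, e2]
        linear_combination h3 - hkl
      rw [this, ← map_neg, add_zero]
      congr 1
      ring
    · rw [if_neg (show ¬(m + 1 < 0 ∧ n < 0) by omega), if_neg (show ¬(m < 0 ∧ n < 0) by omega)]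
      simp
  · rw [if_pos rfl]
    by_cases hn : n < 0
    · rw [if_neg (show ¬(0 ≤ (-1 : ℤ) + 1 ∧ 0 ≤ n) by omega),
        if_neg (show ¬((-1 : ℤ) + 1 < 0 ∧ n < 0) by omega),
        if_neg (show ¬(0 ≤ (-1 : ℤ) ∧ 0 ≤ n) by omega), if_pos (show (-1 : ℤ) < 0 ∧ n < 0 by omega)]
      simp only [PowerSeries.monomial_mul_monomial]
      have : l + tri (b + 1 - n) = k + (tri (b - n) + (-1 * n).toNat) := by
        zify
        rw [Int.toNat_of_nonneg (by omega)]
        linear_combination h3 - hkl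
      rw [this, ← map_neg, ← map_add, mul_zero, mul_zero]
      symm
      refine (congrArg (PowerSeries.monomial _) ?_).trans (LinearMap.map_zero _)
      ring
    · rw [if_pos (show 0 ≤ (-1 : ℤ) + 1 ∧ 0 ≤ n by omega),
        if_neg (show ¬(0 ≤ (-1 : ℤ) ∧ 0 ≤ n) by omega),
        if_neg (show ¬((-1 : ℤ) < 0 ∧ n < 0) by omega)]
      simp
  · rw [if_neg hm.ne', if_neg (show ¬(m + 1 < 0 ∧ n < 0) by omega),
      if_neg (show ¬(m < 0 ∧ n < 0) by omega)]
    by_cases hn : n < 0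
    · rw [if_neg (show ¬(0 ≤ m + 1 ∧ 0 ≤ n) by omega), if_neg (show ¬(0 ≤ m ∧ 0 ≤ n) by omega)]
      simp
    · rw [if_pos (show 0 ≤ m + 1 ∧ 0 ≤ n by omega), if_pos (show 0 ≤ m ∧ 0 ≤ n by omega)]
      simp only [PowerSeries.monomial_mul_monomial]
      have e1 := Int.toNat_of_nonneg (mul_nonneg (show 0 ≤ m + 1 by omega) (show 0 ≤ n by omega))
      have e2 := Int.toNat_of_nonneg (mul_nonneg (show 0 ≤ m by omega) (show 0 ≤ n by omega))
      have : l + (tri (b + 1 - n) + ((m + 1) * n).toNat) =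
          k + (tri (b - n) + (m * n).toNat) := by
        zify
        rw [e1, e2]
        linear_combination h3 - hkl
      rw [this, ← map_neg, add_zero]
      congr 1
      ring

/-! ### The convolution of two theta series with Kronecker's kernel. -/

/-- The summands of `conv`. -/
def convTerm (a b : ℤ) (p : ℤ × ℤ) : PowerSeries ℚ :=
  jac (a - p.1) * jac (b - p.2) * ker p.1 p.2

/-- The coefficient of `x^a y^b` in the product of `∑ jac i x^i`, `∑ jac j y^j` and
`∑ ker m n x^m y^n`. -/
def conv (a b : ℤ) : PowerSeries ℚ := ∑' p, convTerm a b p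

theorem null_jac_sub (a : ℤ) : Null fun m => jac (a - m) :=
  null_jac.comp (Equiv.subLeft a).injective

theorem null_convTerm (a b : ℤ) : Null (convTerm a b) :=
  ((null_jac_sub a).mul_prod (null_jac_sub b)).mul_right fun p => ker p.1 p.2

theorem conv_comm (a b : ℤ) : conv a b = conv b a := by
  rw [conv, conv, ← (Equiv.prodComm ℤ ℤ).tsum_eq]
  refine tsum_congr fun p => ?_
  simp only [convTerm, Equiv.prodComm_apply, Prod.fst_swap, Prod.snd_swap, ker_comm p.2 p.1]
  ring

/-- Sum `jac_mul_ker_succ` over all `m`, `n`: the boundary term at `m = -1` carries the factor `∑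
jac = 0`. -/
theorem conv_succ (a b : ℤ) (k l : ℕ) (hkl : (k : ℤ) - l = b + 1) :
    PowerSeries.X ^ l * conv (a + 1) (b + 1) = -(PowerSeries.X ^ k * conv a b) := by
  have hδ : Null fun m : ℤ => if m = -1 then PowerSeries.X ^ l * jac (a - m) else 0 := by
    intro N
    refine (Set.finite_singleton (-1 : ℤ)).subset fun m hm => ?_
    by_contra hne
    refine hm ?_
    dsimp only
    rw [if_neg (by simpa using hne), map_zero]
  have hprod : ∑' p : ℤ × ℤ, (if p.1 = -1 then PowerSeries.X ^ l * jac (a - p.1) else 0) *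
      jac (b + 1 - p.2) = 0 := by
    rw [← hδ.summable.tsum_mul_tsum (null_jac_sub (b + 1)).summable
      (hδ.mul_prod (null_jac_sub (b + 1))).summable]
    have : ∑' n, jac (b + 1 - n) = 0 := by
      rw [← tsum_jac]
      exact (Equiv.subLeft (b + 1)).tsum_eq jac
    rw [this, mul_zero]
  have hshift : conv (a + 1) (b + 1) =
      ∑' p : ℤ × ℤ, convTerm (a + 1) (b + 1) (p.1 + 1, p.2) := by
    rw [conv, ← ((Equiv.addRight (1 : ℤ)).prodCongr (Equiv.refl ℤ)).tsum_eq]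
    rfl
  have hnull : Null fun p : ℤ × ℤ => convTerm (a + 1) (b + 1) (p.1 + 1, p.2) :=
    (null_convTerm (a + 1) (b + 1)).comp
      ((Equiv.addRight (1 : ℤ)).prodCongr (Equiv.refl ℤ)).injective
  have hneg : Null fun p : ℤ × ℤ => -(convTerm a b p * PowerSeries.X ^ k) :=
    ((null_convTerm a b).mul_right _).neg
  calc PowerSeries.X ^ l * conv (a + 1) (b + 1)
      = ∑' p : ℤ × ℤ, PowerSeries.X ^ l * convTerm (a + 1) (b + 1) (p.1 + 1, p.2) := by
        rw [hshift, hnull.summable.tsum_mul_left]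
    _ = ∑' p : ℤ × ℤ, (-(convTerm a b p * PowerSeries.X ^ k) +
          (if p.1 = -1 then PowerSeries.X ^ l * jac (a - p.1) else 0) * jac (b + 1 - p.2)) := by
        refine tsum_congr fun p => ?_
        have h := jac_mul_ker_succ b p.1 p.2 k l hkl
        simp only [convTerm, show a + 1 - (p.1 + 1) = a - p.1 by ring]
        split_ifs at h ⊢ with hp <;> linear_combination jac (a - p.1) * h
    _ = -(PowerSeries.X ^ k * conv a b) := by
        rw [hneg.summable.tsum_add (hδ.mul_prod (null_jac_sub (b + 1))).summable, hprod, add_zero,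
          tsum_neg, (null_convTerm a b).summable.tsum_mul_right, conv, mul_comm]

/-- By symmetry the same shift multiplies `conv a b` by `-q^(b+1)` and by `-q^(a+1)`. -/
theorem conv_of_ne {a b : ℤ} (hab : a ≠ b) : conv a b = 0 := by
  obtain ⟨k, l, h⟩ : ∃ k l : ℕ, (k : ℤ) - l = b + 1 :=
    ⟨(b + 1).toNat, (-(b + 1)).toNat, by omega⟩
  obtain ⟨k', l', h'⟩ : ∃ k l : ℕ, (k : ℤ) - l = a + 1 :=
    ⟨(a + 1).toNat, (-(a + 1)).toNat, by omega⟩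
  have e1 := conv_succ a b k l h
  have e2 := conv_succ b a k' l' h'
  rw [conv_comm (b + 1), conv_comm b] at e2
  have e3 : (PowerSeries.X ^ (k + l') - PowerSeries.X ^ (k' + l)) * conv a b = 0 := by
    rw [pow_add, pow_add]
    linear_combination PowerSeries.X ^ l' * e1 - PowerSeries.X ^ l * e2
  refine (mul_eq_zero.1 e3).resolve_left fun h0 => ?_
  have h1 := congrArg (PowerSeries.coeff (k + l')) h0
  rw [map_sub, PowerSeries.coeff_X_pow_self, PowerSeries.coeff_X_pow, if_neg (by omega)] at h1
  simp at h1

theorem jac_succ (a : ℤ) (k l : ℕ) (hkl : (k : ℤ) - l = a + 1) :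
    PowerSeries.X ^ l * jac (a + 1) = -(PowerSeries.X ^ k * jac a) := by
  have h := jac_mul_ker_succ a 0 0 k l hkl
  simpa [ker] using h

/-- Both sides obey the recursion of `jac_succ`, which can be run in both directions because powers
of `q` cancel. -/
theorem conv_self (a : ℤ) : conv a a = jac a * conv 0 0 := by
  have key : ∀ a : ℤ, conv a a = jac a * conv 0 0 ↔
      conv (a + 1) (a + 1) = jac (a + 1) * conv 0 0 := by
    intro a
    obtain ⟨k, l, h⟩ : ∃ k l : ℕ, (k : ℤ) - l = a + 1 :=
      ⟨(a + 1).toNat, (-(a + 1)).toNat, by omega⟩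
    have e1 := conv_succ a a k l h
    have e2 := jac_succ a k l h
    have hX : ∀ n : ℕ, (PowerSeries.X ^ n : PowerSeries ℚ) ≠ 0 :=
      fun n => pow_ne_zero _ PowerSeries.X_ne_zero
    constructor
    · intro h0
      refine mul_left_cancel₀ (hX l) ?_
      rw [e1, h0]
      linear_combination -e2 * conv 0 0
    · intro h0
      refine mul_left_cancel₀ (hX k) ?_
      rw [h0] at e1
      linear_combination e1 - e2 * conv 0 0
  have h0 : conv 0 0 = jac 0 * conv 0 0 := by simp [jac, tri]
  induction a using Int.induction_on with
  | zero => exact h0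
  | succ i ih => exact (key _).1 ih
  | pred i ih => exact (key _).2 (by rw [sub_add_cancel]; exact ih)

/-- `q^(-1/8) θ'(0)`. -/
def jacDeriv : PowerSeries ℚ := ∑' i : ℤ, jac i * PowerSeries.C ((i : ℚ) + 1 / 2)

/-- The line `m + n = s` contains `s + 1` points with sign `+` if `s ≥ 0`, and `-s - 1` points with
sign `-` if `s < 0`; the signed count is `s + 1` in both cases. -/
theorem hasSum_sign (s : ℤ) : HasSum (fun m : ℤ =>
    if 0 ≤ m ∧ 0 ≤ s - m then (1 : PowerSeries ℚ) else if m < 0 ∧ s - m < 0 then -1 else 0)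
    (PowerSeries.C ((s : ℚ) + 1)) := by
  rcases le_or_gt 0 s with hs | hs
  · have h : ∑ m ∈ Finset.Icc 0 s, (if 0 ≤ m ∧ 0 ≤ s - m then (1 : PowerSeries ℚ)
        else if m < 0 ∧ s - m < 0 then -1 else 0) = PowerSeries.C ((s : ℚ) + 1) := by
      rw [Finset.sum_congr rfl (g := fun _ => 1)]
      · rw [Finset.sum_const, Int.card_Icc, nsmul_one]
        lift s to ℕ using hs
        simp
      · intro m hm
        rw [Finset.mem_Icc] at hm
        rw [if_pos (by omega)]
    rw [← h]
    refine hasSum_sum_of_ne_finset_zero fun m hm => ?_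
    rw [Finset.mem_Icc] at hm
    rw [if_neg (by omega), if_neg (by omega)]
  · have h : ∑ m ∈ Finset.Ioo s 0, (if 0 ≤ m ∧ 0 ≤ s - m then (1 : PowerSeries ℚ)
        else if m < 0 ∧ s - m < 0 then -1 else 0) = PowerSeries.C ((s : ℚ) + 1) := by
      rw [Finset.sum_congr rfl (g := fun _ => -1)]
      · rw [Finset.sum_const, Int.card_Ioo, smul_neg, nsmul_one]
        obtain ⟨k, rfl⟩ : ∃ k : ℕ, s = -(k : ℤ) - 1 := ⟨(-s - 1).toNat, by omega⟩
        simp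
      · intro m hm
        rw [Finset.mem_Ioo] at hm
        rw [if_neg (by omega), if_pos (by omega)]
    rw [← h]
    refine hasSum_sum_of_ne_finset_zero fun m hm => ?_
    rw [Finset.mem_Ioo] at hm
    rw [if_neg (by omega), if_neg (by omega)]

/-- The power of `q` is constant on the line `m + n = s`: completing the square, the three exponents
add up to `s (s - 1) / 2`. -/
theorem convTerm_zero (s m : ℤ) : convTerm 0 0 (m, s - m) = -jac (s - 1) *
    if 0 ≤ m ∧ 0 ≤ s - m then (1 : PowerSeries ℚ) else if m < 0 ∧ s - m < 0 then -1 else 0 := by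
  have h1 := two_mul_tri (0 - m)
  have h2 := two_mul_tri (0 - (s - m))
  have h3 := two_mul_tri (s - 1)
  have hsign : (-1 : ℚ) ^ (0 - m) * (-1) ^ (0 - (s - m)) = -(-1) ^ (s - 1) := by
    rw [← zpow_add₀ (by norm_num), show 0 - m + (0 - (s - m)) = -s by ring, zpow_neg, ← inv_zpow,
      zpow_sub_one₀ (by norm_num)]
    norm_num
  have hexp : 0 ≤ m * (s - m) →
      tri (0 - m) + tri (0 - (s - m)) + (m * (s - m)).toNat = tri (s - 1) := by
    intro h
    zify
    rw [Int.toNat_of_nonneg h]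
    linarith
  rw [convTerm, ker]
  dsimp only
  split_ifs with h h'
  · simp only [jac, PowerSeries.monomial_mul_monomial]
    rw [hexp (mul_nonneg h.1 h.2), hsign, mul_one, mul_one, map_neg]
  · simp only [jac, PowerSeries.monomial_mul_monomial]
    rw [hexp (mul_nonneg_of_nonpos_of_nonpos h'.1.le h'.2.le), hsign, ← map_neg]
    simp
  · simp

theorem conv_zero_zero : conv 0 0 = -jacDeriv := by
  have h0 : HasSum (convTerm 0 0) (conv 0 0) := (null_convTerm 0 0).summable.hasSum
  let φ : ℤ × ℤ ≃ ℤ × ℤ :=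
    { toFun := fun p => (p.2, p.1 - p.2)
      invFun := fun p => (p.1 + p.2, p.1)
      left_inv := fun p => by ext <;> simp
      right_inv := fun p => by ext <;> simp }
  rw [← φ.hasSum_iff] at h0
  -- Regularity is required for summation along the fibres of `s = m + n`.
  have : RegularSpace (PowerSeries ℚ) := inferInstanceAs (RegularSpace ((Unit →₀ ℕ) → ℚ))
  have h1 := h0.prod_fiberwise (g := fun s : ℤ => -jac (s - 1) * PowerSeries.C ((s : ℚ) + 1))
    fun s => by
      simp only [Function.comp, φ, Equiv.coe_fn_mk, convTerm_zero]
      exact (hasSum_sign s).mul_left _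
  have hnull : Null fun i => jac i * PowerSeries.C ((i : ℚ) + 1 / 2) := null_jac.mul_right _
  -- With `s = i + 1` the weight is `s + 1 = (i + 1/2) + 3/2`, and the part `3/2` contributes a
  -- multiple of `∑ jac = 0`.
  rw [← h1.tsum_eq, ← (Equiv.addRight (1 : ℤ)).tsum_eq, jacDeriv, ← tsum_neg,
    ← sub_zero (∑' i : ℤ, -(jac i * PowerSeries.C ((i : ℚ) + 1 / 2))),
    ← mul_zero (PowerSeries.C (3 / 2 : ℚ)), ← tsum_jac, ← null_jac.summable.tsum_mul_left,
    ← hnull.neg.summable.tsum_sub (null_jac.summable.mul_left _)]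
  refine tsum_congr fun i => ?_
  simp only [Equiv.coe_addRight, add_sub_cancel_right]
  have : PowerSeries.C (((i + 1 : ℤ) : ℚ) + 1) =
      PowerSeries.C ((i : ℚ) + 1 / 2) + PowerSeries.C (3 / 2 : ℚ) := by
    rw [← map_add]
    congr 1
    push_cast
    ring
  rw [this]
  ring

theorem conv_eq (a b : ℤ) : conv a b = if a = b then -(jacDeriv * jac a) else 0 := by
  split_ifs with h
  · rw [← h, conv_self, conv_zero_zero]
    ring
  · exact conv_of_ne h

/-! ## Exponential series in `u` and `v` -/

theorem coeff_subst_mul_subst {R : Type*} [CommRing R] (f g : PowerSeries R)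
    (e : Vars 1 →₀ ℕ) :
    MvPowerSeries.coeff e (PowerSeries.subst (MvPowerSeries.X (.inl 0) : MvPowerSeries (Vars 1) R) f *
      PowerSeries.subst (MvPowerSeries.X (.inr 0) : MvPowerSeries (Vars 1) R) g) =
      PowerSeries.coeff (e (.inl 0)) f * PowerSeries.coeff (e (.inr 0)) g := by
  classical
  rw [MvPowerSeries.coeff_mul, Finset.sum_eq_single
    (Finsupp.single (.inl 0) (e (.inl 0)), Finsupp.single (.inr 0) (e (.inr 0))) ?_ ?_]
  · simp [PowerSeries.coeff_subst_single]
  · intro b hb hb'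
    by_contra hne
    rcases ne_zero_and_ne_zero_of_mul hne with ⟨h0, h1⟩
    simp only [PowerSeries.coeff_subst_single, ne_eq, ite_eq_right_iff, not_forall,
      exists_prop] at h0 h1
    apply hb'
    rw [Prod.ext_iff, ← Finset.HasAntidiagonal.mem_antidiagonal.mp hb, h0.1, h1.1]
    simp
  · intro he
    refine absurd (Finset.HasAntidiagonal.mem_antidiagonal.mpr ?_) he
    ext s
    rcases s with s | s <;> rw [Subsingleton.elim s 0] <;> simp

/-- Power series in `u` and `v` over the power series in `q`. -/
abbrev UV : Type := MvPowerSeries (Vars 1) (PowerSeries ℚ)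

/-- The series `f(u)`. -/
def inU (f : PowerSeries (PowerSeries ℚ)) : UV := PowerSeries.subst (MvPowerSeries.X (.inl 0) : UV) f

/-- The series `f(v)`. -/
def inV (f : PowerSeries (PowerSeries ℚ)) : UV := PowerSeries.subst (MvPowerSeries.X (.inr 0) : UV) f

theorem inU_mul (f g : PowerSeries (PowerSeries ℚ)) : inU (f * g) = inU f * inU g :=
  PowerSeries.subst_mul (PowerSeries.HasSubst.X _) _ _

theorem inV_mul (f g : PowerSeries (PowerSeries ℚ)) : inV (f * g) = inV f * inV g :=
  PowerSeries.subst_mul (PowerSeries.HasSubst.X _) _ _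

/-- `e^(a z)`. -/
def expMul (a : ℚ) : PowerSeries (PowerSeries ℚ) :=
  PowerSeries.rescale (PowerSeries.C a) (PowerSeries.exp (PowerSeries ℚ))

theorem expMul_mul (a b : ℚ) : expMul a * expMul b = expMul (a + b) := by
  rw [expMul, expMul, PowerSeries.exp_mul_exp_eq_exp_add, ← map_add]; rfl

theorem expMul_zero : expMul 0 = 1 := by
  rw [expMul, map_zero, PowerSeries.rescale_zero]
  simp

theorem expMul_one : expMul 1 = PowerSeries.exp (PowerSeries ℚ) := by
  rw [expMul, map_one, PowerSeries.rescale_one]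
  rfl

theorem coeff_expMul (n : ℕ) (a : ℚ) :
    PowerSeries.coeff n (expMul a) = PowerSeries.C (a ^ n / n.factorial) := by
  rw [expMul, PowerSeries.coeff_rescale, PowerSeries.coeff_exp, PowerSeries.algebraMap_apply,
    ← map_pow, ← map_mul]
  simp [div_eq_mul_inv]

/-- `e^(a u + b v)`. -/
def ex (a b : ℚ) : UV := inU (expMul a) * inV (expMul b)

theorem ex_mul (a b a' b' : ℚ) : ex a b * ex a' b' = ex (a + a') (b + b') := by
  rw [ex, ex, ex, ← expMul_mul, ← expMul_mul, inU_mul, inV_mul]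
  ring

theorem coeff_ex (a b : ℚ) (e : Vars 1 →₀ ℕ) : MvPowerSeries.coeff e (ex a b) =
    PowerSeries.C (a ^ e (.inl 0) / (e (.inl 0)).factorial *
      (b ^ e (.inr 0) / (e (.inr 0)).factorial)) := by
  rw [ex, inU, inV, coeff_subst_mul_subst, coeff_expMul, coeff_expMul, ← map_mul]

theorem ex_zero : ex 0 0 = 1 := by
  classical
  refine MvPowerSeries.ext fun e => ?_
  rw [coeff_ex, MvPowerSeries.coeff_one]
  split_ifs with h
  · simp [h]
  · rw [← map_zero PowerSeries.C]
    congr 1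
    by_contra hne
    apply h
    ext s
    rcases s with s | s
    · by_contra h0
      rw [Subsingleton.elim s 0] at h0
      exact hne (by rw [zero_pow h0]; simp)
    · by_contra h0
      rw [Subsingleton.elim s 0] at h0
      exact hne (by rw [zero_pow h0]; simp)

/-- Multiplication by `e^u` or `e^v` shifts an index by one. The offset `α` is `0` for the kernel
and `1/2` for theta series. -/
theorem hasSum_second_difference {c : ℤ → ℤ → PowerSeries ℚ} {α : ℚ} {W : UV}
    (h : HasSum (fun p : ℤ × ℤ => MvPowerSeries.C (c p.1 p.2) * ex (p.1 + α) (p.2 + α)) W) :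
    HasSum (fun p : ℤ × ℤ => MvPowerSeries.C (c p.1 p.2 - c (p.1 - 1) p.2 - c p.1 (p.2 - 1)
      + c (p.1 - 1) (p.2 - 1)) * ex (p.1 + α) (p.2 + α)) ((1 - ex 1 0) * (1 - ex 0 1) * W) := by
  have shift : ∀ i j : ℤ, HasSum (fun p : ℤ × ℤ =>
      MvPowerSeries.C (c (p.1 - i) (p.2 - j)) * ex (p.1 + α) (p.2 + α)) (ex i j * W) := by
    intro i j
    have h1 := h.mul_left (ex i j)
    rw [← ((Equiv.subRight i).prodCongr (Equiv.subRight j)).hasSum_iff] at h1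
    convert! h1 using 2 with p
    simp only [Function.comp, Equiv.prodCongr_apply, Prod.map, Equiv.subRight_apply]
    rw [mul_left_comm, ex_mul]
    congr 2 <;> push_cast <;> ring
  have h00 := shift 0 0
  have h10 := shift 1 0
  have h01 := shift 0 1
  have h11 := shift 1 1
  convert! ((h00.sub h10).sub h01).add h11 using 1
  · funext p
    simp only [map_add, map_sub, sub_zero]
    ring
  · have e11 : ex ((1 : ℤ) : ℚ) ((1 : ℤ) : ℚ) = ex 1 0 * ex 0 1 := by
      rw [ex_mul]
      norm_num
    rw [e11]
    simp only [Int.cast_zero, Int.cast_one, ex_zero]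
    ring

/-! ## The regular part of the kernel -/

/-- The part of `ker` with `m n ≠ 0`. -/
def kerReg (m n : ℤ) : PowerSeries ℚ :=
  if 0 < m ∧ 0 < n then PowerSeries.monomial (m * n).toNat 1
  else if m < 0 ∧ n < 0 then PowerSeries.monomial (m * n).toNat (-1) else 0

theorem coeff_kerReg (N : ℕ) (m n : ℤ) : PowerSeries.coeff N (kerReg m n) =
    if m * n = N ∧ 0 < m ∧ 0 < n then 1 else if m * n = N ∧ m < 0 ∧ n < 0 then -1 else 0 := by
  rw [kerReg]
  by_cases h1 : 0 < m ∧ 0 < n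
  · have := mul_pos h1.1 h1.2
    rw [if_pos h1, PowerSeries.coeff_monomial]
    by_cases h2 : m * n = N
    · rw [if_pos (by omega), if_pos ⟨h2, h1⟩]
    · rw [if_neg (by omega), if_neg (by tauto), if_neg (by tauto)]
  · rw [if_neg h1]
    by_cases h3 : m < 0 ∧ n < 0
    · have := mul_pos_of_neg_of_neg h3.1 h3.2
      rw [if_pos h3, PowerSeries.coeff_monomial]
      by_cases h2 : m * n = N
      · rw [if_pos (by omega), if_neg (by tauto), if_pos ⟨h2, h3⟩]
      · rw [if_neg (by omega), if_neg (by tauto), if_neg (by tauto)]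
    · rw [if_neg h3, map_zero, if_neg (by tauto), if_neg (by tauto)]

theorem null_kerReg : Null fun p : ℤ × ℤ => kerReg p.1 p.2 := by
  intro N
  refine ((Set.finite_Icc (-(N : ℤ)) N).prod (Set.finite_Icc (-(N : ℤ)) N)).subset ?_
  rintro ⟨m, n⟩ h
  simp only [Set.mem_ofPred_eq, coeff_kerReg] at h
  have h' : m * n = N ∧ ((0 < m ∧ 0 < n) ∨ (m < 0 ∧ n < 0)) := by
    by_contra hcon
    exact h (by rw [if_neg (by tauto), if_neg (by tauto)])
  simp only [Set.mem_prod, Set.mem_Icc]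
  rcases h' with ⟨h1, ⟨h2, h3⟩ | ⟨h2, h3⟩⟩
  · refine ⟨⟨?_, ?_⟩, ?_, ?_⟩ <;> nlinarith
  · refine ⟨⟨?_, ?_⟩, ?_, ?_⟩ <;> nlinarith

/-- The indicator function of `n ≥ 0`. -/
def step (n : ℤ) : PowerSeries ℚ := if 0 ≤ n then 1 else 0

/-- The indicator function of `n = 0`. -/
def delta (n : ℤ) : PowerSeries ℚ := if n = 0 then 1 else 0

theorem step_sub_step (n : ℤ) : step n - step (n - 1) = delta n := by
  simp only [step, delta]
  rcases lt_trichotomy n 0 with h | rfl | h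
  · rw [if_neg (by omega), if_neg (by omega), if_neg (by omega), sub_zero]
  · simp
  · rw [if_pos (by omega), if_pos (by omega), if_neg (by omega), sub_self]

/-- The terms with `m n = 0` form the indicator of a quadrant minus that of the quadrant shifted by
`(1, 1)`. Its second difference is supported at `(0, 0)` and `(1, 1)`, which yields the numerator `1
- x y` of `-½ coth(u/2) - ½ coth(v/2)`. -/
theorem ker_eq_kerReg_add (m n : ℤ) :
    ker m n = kerReg m n + (step m * step n - step (m - 1) * step (n - 1)) := by
  simp only [ker, kerReg, step]
  rcases lt_trichotomy m 0 with hm | rfl | hm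
  · rw [if_neg (show ¬(0 ≤ m ∧ 0 ≤ n) by omega), if_neg (show ¬(0 < m ∧ 0 < n) by omega),
      if_neg (show ¬(0 ≤ m) by omega), if_neg (show ¬(0 ≤ m - 1) by omega)]
    simp
  · rcases lt_or_ge n 0 with hn | hn
    · rw [if_neg (show ¬(0 ≤ (0 : ℤ) ∧ 0 ≤ n) by omega), if_neg (show ¬(0 ≤ n) by omega)]
      simp
    · rw [if_pos (show (0 ≤ (0 : ℤ) ∧ 0 ≤ n) by omega), if_pos hn]
      simp
  · rcases lt_trichotomy n 0 with hn | rfl | hn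
    · rw [if_neg (show ¬(0 ≤ m ∧ 0 ≤ n) by omega), if_neg (show ¬(0 < m ∧ 0 < n) by omega),
        if_neg (show ¬(0 ≤ n) by omega), if_neg (show ¬(0 ≤ n - 1) by omega)]
      simp
    · rw [if_pos (show (0 ≤ m ∧ 0 ≤ (0 : ℤ)) by omega), if_pos (show 0 ≤ m by omega)]
      simp
    · rw [if_pos (show (0 ≤ m ∧ 0 ≤ n) by omega), if_pos (show (0 < m ∧ 0 < n) by omega),
        if_pos (show (0 ≤ n) by omega), if_pos (show (0 ≤ n - 1) by omega),
        if_pos (show (0 ≤ m) by omega), if_pos (show (0 ≤ m - 1) by omega)]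
      simp

/-- The second difference of `ker`. -/
def kerDiff (m n : ℤ) : PowerSeries ℚ :=
  ker m n - ker (m - 1) n - ker m (n - 1) + ker (m - 1) (n - 1)

theorem kerDiff_eq (m n : ℤ) : kerDiff m n = (kerReg m n - kerReg (m - 1) n - kerReg m (n - 1)
    + kerReg (m - 1) (n - 1)) + (delta m * delta n - delta (m - 1) * delta (n - 1)) := by
  simp only [kerDiff, ker_eq_kerReg_add, ← step_sub_step]
  ring

theorem null_delta_mul (i : ℤ) : Null fun p : ℤ × ℤ => delta (p.1 - i) * delta (p.2 - i) := by
  intro N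
  refine (Set.finite_singleton (i, i)).subset fun p hp => ?_
  by_contra hne
  have : p.1 - i ≠ 0 ∨ p.2 - i ≠ 0 := by
    by_contra! hcon
    exact hne (Prod.ext (by dsimp only; omega) (by dsimp only; omega))
  refine hp ?_
  simp only [delta]
  rcases this with h | h <;> simp [h]

theorem null_kerDiff : Null fun p : ℤ × ℤ => kerDiff p.1 p.2 := by
  have hs : ∀ i j : ℤ, Null fun p : ℤ × ℤ => kerReg (p.1 - i) (p.2 - j) := fun i j =>
    null_kerReg.comp ((Equiv.subRight i).prodCongr (Equiv.subRight j)).injective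
  have h := ((((hs 0 0).sub (hs 1 0)).sub (hs 0 1)).add (hs 1 1)).add
    ((null_delta_mul 0).sub (null_delta_mul 1))
  simpa only [kerDiff_eq, sub_zero] using h

/-- `∑_{m, n ≥ 1} q^(m n) (x^m y^n - x^(-m) y^(-n))`. -/
def lambert : UV := ∑' p : ℤ × ℤ, MvPowerSeries.C (kerReg p.1 p.2) * ex p.1 p.2

theorem hasSum_kerDiff : HasSum (fun p : ℤ × ℤ => MvPowerSeries.C (kerDiff p.1 p.2) * ex p.1 p.2)
    ((1 - ex 1 0) * (1 - ex 0 1) * lambert + (1 - ex 1 1)) := by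
  have h1 : HasSum (fun p : ℤ × ℤ => MvPowerSeries.C (kerReg p.1 p.2) * ex p.1 p.2) lambert :=
    (null_kerReg.summable_C_mul fun p : ℤ × ℤ => ex p.1 p.2).hasSum
  have h2 := hasSum_second_difference (c := kerReg) (α := 0) (W := lambert)
    (by simpa only [add_zero] using h1)
  have h3 : ∀ i : ℤ, HasSum (fun p : ℤ × ℤ =>
      MvPowerSeries.C (delta (p.1 - i) * delta (p.2 - i)) * ex p.1 p.2) (ex i i) := by
    intro i
    have h := hasSum_single (f := fun p : ℤ × ℤ =>
      MvPowerSeries.C (delta (p.1 - i) * delta (p.2 - i)) * ex p.1 p.2) (i, i) ?_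
    · simpa only [delta, sub_self, if_true, mul_one, map_one, one_mul] using h
    · intro p hp
      have : p.1 - i ≠ 0 ∨ p.2 - i ≠ 0 := by
        by_contra! hcon
        exact hp (Prod.ext (by dsimp only; omega) (by dsimp only; omega))
      simp only [delta]
      rcases this with h | h <;> simp [h]
  have h4 := h2.add ((h3 0).sub (h3 1))
  convert! h4 using 1
  · funext p
    simp only [kerDiff_eq, add_zero, sub_zero, map_add, map_sub]
    ring
  · simp [ex_zero]

/-! ## The product identity -/

/-- `q^(-1/8) θ(u)`. -/
def jacU : UV := ∑' i : ℤ, MvPowerSeries.C (jac i) * ex (i + 1 / 2) 0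

/-- `q^(-1/8) θ(v)`. -/
def jacV : UV := ∑' i : ℤ, MvPowerSeries.C (jac i) * ex 0 (i + 1 / 2)

/-- `q^(-1/8) θ(u + v)`. -/
def jacUV : UV := ∑' i : ℤ, MvPowerSeries.C (jac i) * ex (i + 1 / 2) (i + 1 / 2)

theorem hasSum_conv : HasSum
    (fun p : ℤ × ℤ => MvPowerSeries.C (conv p.1 p.2) * ex (p.1 + 1 / 2) (p.2 + 1 / 2))
    (-(MvPowerSeries.C jacDeriv * jacUV)) := by
  have h1 := ((null_jac.summable_C_mul
    fun i : ℤ => ex (i + 1 / 2) (i + 1 / 2)).hasSum.mul_left (-MvPowerSeries.C jacDeriv))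
  have hinj : Function.Injective fun i : ℤ => (i, i) := fun i j h => (Prod.ext_iff.1 h).1
  rw [← neg_mul, ← hinj.hasSum_iff]
  · convert! h1 using 1
    funext i
    simp only [Function.comp, conv_eq, if_true, map_neg, map_mul]
    ring
  · rintro ⟨a, b⟩ h
    have : a ≠ b := by
      rintro rfl
      exact h ⟨a, rfl⟩
    simp only [conv_eq, if_neg this, map_zero, zero_mul]

theorem hasSum_jac_mul_kerDiff (a b : ℤ) :
    HasSum (fun p : ℤ × ℤ => jac (a - p.1) * jac (b - p.2) * kerDiff p.1 p.2)
      (conv a b - conv (a - 1) b - conv a (b - 1) + conv (a - 1) (b - 1)) := by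
  have shift : ∀ i j : ℤ, HasSum (fun p : ℤ × ℤ =>
      jac (a - p.1) * jac (b - p.2) * ker (p.1 - i) (p.2 - j)) (conv (a - i) (b - j)) := by
    intro i j
    have h := (null_convTerm (a - i) (b - j)).summable.hasSum
    rw [← ((Equiv.subRight i).prodCongr (Equiv.subRight j)).hasSum_iff] at h
    convert! h using 2 with p
    simp only [convTerm, Function.comp, Equiv.prodCongr_apply, Prod.map, Equiv.subRight_apply,
      sub_sub_sub_cancel_right]
  have h00 := shift 0 0
  have h10 := shift 1 0
  have h01 := shift 0 1
  have h11 := shift 1 1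
  simp only [sub_zero] at h00 h10 h01
  convert! ((h00.sub h10).sub h01).add h11 using 1
  funext p
  simp only [kerDiff]
  ring

theorem t3Space_UV : T3Space UV :=
  have : T3Space (PowerSeries ℚ) := inferInstanceAs (T3Space ((Unit →₀ ℕ) → ℚ))
  inferInstanceAs (T3Space ((Vars 1 →₀ ℕ) → PowerSeries ℚ))

theorem HasSum.mul_UV {ι κ : Type*} {f : ι → UV} {g : κ → UV} {s t : UV} (hf : HasSum f s)
    (hg : HasSum g t) (hfg : Summable fun x : ι × κ => f x.1 * g x.2) :
    HasSum (fun x : ι × κ => f x.1 * g x.2) (s * t) :=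
  have := t3Space_UV
  _root_.HasSum.mul hf hg hfg

/-- Kronecker's identity multiplied by `(1 - x)(1 - y)`. The fourfold sum of the left side is
grouped by total exponent; each fibre is a second difference of `conv`, and these sum to the right
side by `hasSum_conv`. -/
theorem jacU_mul_jacV_mul : jacU * jacV * ((1 - ex 1 0) * (1 - ex 0 1) * lambert + (1 - ex 1 1)) =
    (1 - ex 1 0) * (1 - ex 0 1) * -(MvPowerSeries.C jacDeriv * jacUV) := by
  have := t3Space_UV
  have hU : HasSum (fun i : ℤ => MvPowerSeries.C (jac i) * ex (i + 1 / 2) 0) jacU :=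
    (null_jac.summable_C_mul fun i : ℤ => ex (i + 1 / 2) 0).hasSum
  have hV : HasSum (fun i : ℤ => MvPowerSeries.C (jac i) * ex 0 (i + 1 / 2)) jacV :=
    (null_jac.summable_C_mul fun i : ℤ => ex 0 (i + 1 / 2)).hasSum
  have hUV : HasSum (fun p : ℤ × ℤ => MvPowerSeries.C (jac p.1 * jac p.2) *
      ex (p.1 + 1 / 2) (p.2 + 1 / 2)) (jacU * jacV) := by
    have hs := (null_jac.mul_prod null_jac).summable_C_mul
      fun p : ℤ × ℤ => ex (p.1 + 1 / 2) (p.2 + 1 / 2)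
    have hfun : (fun p : ℤ × ℤ => MvPowerSeries.C (jac p.1 * jac p.2) *
        ex (p.1 + 1 / 2) (p.2 + 1 / 2)) = fun p : ℤ × ℤ =>
        (MvPowerSeries.C (jac p.1) * ex (p.1 + 1 / 2) 0) *
        (MvPowerSeries.C (jac p.2) * ex 0 (p.2 + 1 / 2)) := by
      funext p
      rw [mul_mul_mul_comm, ex_mul, zero_add, add_zero, map_mul]
    rw [hfun] at hs ⊢
    exact HasSum.mul_UV (f := fun i : ℤ => MvPowerSeries.C (jac i) * ex (i + 1 / 2) 0)
      (g := fun i : ℤ => MvPowerSeries.C (jac i) * ex 0 (i + 1 / 2)) hU hV hs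
  have hall : HasSum (fun r : (ℤ × ℤ) × (ℤ × ℤ) =>
      MvPowerSeries.C (jac r.1.1 * jac r.1.2 * kerDiff r.2.1 r.2.2) *
      ex (r.1.1 + r.2.1 + 1 / 2) (r.1.2 + r.2.2 + 1 / 2))
      (jacU * jacV * ((1 - ex 1 0) * (1 - ex 0 1) * lambert + (1 - ex 1 1))) := by
    have hs := ((null_jac.mul_prod null_jac).mul_prod null_kerDiff).summable_C_mul
      fun r => ex (r.1.1 + r.2.1 + 1 / 2) (r.1.2 + r.2.2 + 1 / 2)
    have hfun : (fun r : (ℤ × ℤ) × (ℤ × ℤ) =>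
        MvPowerSeries.C (jac r.1.1 * jac r.1.2 * kerDiff r.2.1 r.2.2) *
        ex (r.1.1 + r.2.1 + 1 / 2) (r.1.2 + r.2.2 + 1 / 2)) = fun r : (ℤ × ℤ) × (ℤ × ℤ) =>
        (MvPowerSeries.C (jac r.1.1 * jac r.1.2) * ex (r.1.1 + 1 / 2) (r.1.2 + 1 / 2)) *
        (MvPowerSeries.C (kerDiff r.2.1 r.2.2) * ex r.2.1 r.2.2) := by
      funext r
      rw [mul_mul_mul_comm, ex_mul, map_mul]
      congr 2 <;> ring
    rw [hfun] at hs ⊢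
    exact HasSum.mul_UV (f := fun p : ℤ × ℤ => MvPowerSeries.C (jac p.1 * jac p.2) *
        ex (p.1 + 1 / 2) (p.2 + 1 / 2))
      (g := fun p : ℤ × ℤ => MvPowerSeries.C (kerDiff p.1 p.2) * ex p.1 p.2)
      hUV hasSum_kerDiff hs
  -- Reindexing by the total exponent `(a, b)` and the kernel index `(m, n)`; the theta indices
  -- become `a - m` and `b - n`.
  let ψ : (ℤ × ℤ) × (ℤ × ℤ) ≃ (ℤ × ℤ) × (ℤ × ℤ) :=
    { toFun := fun r => (r.1 - r.2, r.2)
      invFun := fun r => (r.1 + r.2, r.2)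
      left_inv := fun r => by simp
      right_inv := fun r => by simp }
  rw [← ψ.hasSum_iff] at hall
  have hfib := hall.prod_fiberwise (g := fun p : ℤ × ℤ => MvPowerSeries.C (conv p.1 p.2 -
    conv (p.1 - 1) p.2 - conv p.1 (p.2 - 1) + conv (p.1 - 1) (p.2 - 1)) *
      ex (p.1 + 1 / 2) (p.2 + 1 / 2)) fun p => by
    have h := ((hasSum_jac_mul_kerDiff p.1 p.2).map (MvPowerSeries.C (σ := Vars 1))
      MvPowerSeries.WithPiTopology.continuous_C).mul_right (ex (p.1 + 1 / 2) (p.2 + 1 / 2))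
    convert! h using 1
    funext r
    simp only [Function.comp, ψ, Equiv.coe_fn_mk, Prod.fst_sub, Prod.snd_sub]
    congr 2 <;> push_cast <;> ring
  exact hfib.unique (hasSum_second_difference hasSum_conv)

/-! ## The `q`-bracket of the double moment functions -/

/-- Removing `i` copies of the part `m` is a bijection onto the partitions of `n - m i`. -/
theorem card_partition_le_count (n m i : ℕ) (hm : 1 ≤ m) :
    (Finset.univ.filter fun lam : n.Partition => i ≤ lam.parts.count m).card =
      if m * i ≤ n then Fintype.card (n - m * i).Partition else 0 := by
  have hsum : ∀ lam : n.Partition, i ≤ lam.parts.count m →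
      (lam.parts - Multiset.replicate i m).sum + m * i = n := by
    intro lam h
    have h1 : lam.parts - Multiset.replicate i m + Multiset.replicate i m = lam.parts :=
      tsub_add_cancel_of_le (Multiset.le_count_iff_replicate_le.1 h)
    have h2 := congrArg Multiset.sum h1
    rw [Multiset.sum_add, Multiset.sum_replicate, lam.parts_sum, smul_eq_mul, mul_comm i] at h2
    exact h2
  split_ifs with hle
  · rw [← Finset.card_univ]
    symm
    refine Finset.card_bij (fun (mu : (n - m * i).Partition) _ =>
      ({ parts := mu.parts + Multiset.replicate i m
         parts_pos := by
          intro a ha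
          rcases Multiset.mem_add.1 ha with h | h
          · exact mu.parts_pos h
          · rw [Multiset.eq_of_mem_replicate h]; exact hm
         parts_sum := by
          rw [Multiset.sum_add, Multiset.sum_replicate, mu.parts_sum, smul_eq_mul, mul_comm i]
          omega } : n.Partition)) ?_ ?_ ?_
    · intro mu _
      simp
    · intro mu _ mu' _ h
      have := congrArg Nat.Partition.parts h
      exact Nat.Partition.ext (add_right_cancel this)
    · intro lam hlam
      have h : i ≤ lam.parts.count m := (Finset.mem_filter.1 hlam).2
      refine ⟨{ parts := lam.parts - Multiset.replicate i m
                parts_pos := fun {a} ha => lam.parts_pos (Multiset.mem_of_le tsub_le_self ha)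
                parts_sum := by have := hsum lam h; omega }, Finset.mem_univ _, ?_⟩
      exact Nat.Partition.ext (tsub_add_cancel_of_le (Multiset.le_count_iff_replicate_le.1 h))
  · rw [Finset.card_eq_zero, Finset.filter_eq_empty_iff]
    intro lam _ h
    have := hsum lam h
    omega

/-- `∑_{m, i ≥ 1} m^a i^b q^(m i)`. -/
def divisorSeries (a b : ℕ) : PowerSeries ℚ :=
  PowerSeries.mk fun N => ∑ p ∈ N.divisorsAntidiagonal, (p.1 : ℚ) ^ a * (p.2 : ℚ) ^ b

theorem mult_le (lam : Ptn) (m : ℕ) (hm : 1 ≤ m) : mult lam m ≤ lam.1 := by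
  have h1 : Multiset.replicate (mult lam m) m ≤ lam.2.parts :=
    Multiset.le_count_iff_replicate_le.1 le_rfl
  obtain ⟨s, hs⟩ := Multiset.le_iff_exists_add.1 h1
  have h2 := congrArg Multiset.sum hs
  rw [Multiset.sum_add, Multiset.sum_replicate, lam.2.parts_sum, smul_eq_mul] at h2
  have := Nat.le_mul_of_pos_right (mult lam m) hm
  omega

theorem qGen_moment (k l : ℕ) : qGen (fun lam => ∑ m ∈ Finset.Icc 1 lam.1,
    (m : ℚ) ^ k * faulhaber l (mult lam m)) = divisorSeries k (l - 1) * qGen 1 := by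
  classical
  ext n
  have hone : ∀ r, PowerSeries.coeff r (qGen 1) = (Fintype.card r.Partition : ℚ) := by
    intro r
    simp [qGen, Finset.card_univ]
  have hL : PowerSeries.coeff n (qGen fun lam => ∑ m ∈ Finset.Icc 1 lam.1,
      (m : ℚ) ^ k * faulhaber l (mult lam m)) =
      ∑ m ∈ Finset.Icc 1 n, ∑ i ∈ Finset.Icc 1 n, (m : ℚ) ^ k * (i : ℚ) ^ (l - 1) *
        ((if m * i ≤ n then Fintype.card (n - m * i).Partition else 0 : ℕ) : ℚ) := by
    simp only [qGen, PowerSeries.coeff_mk]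
    rw [Finset.sum_comm]
    refine Finset.sum_congr rfl fun m hm => ?_
    have hm1 := (Finset.mem_Icc.1 hm).1
    rw [← Finset.mul_sum, Finset.sum_congr rfl fun i _ => mul_assoc _ _ _, ← Finset.mul_sum]
    congr 1
    have h1 : ∀ lam : n.Partition, faulhaber l (mult ⟨n, lam⟩ m) =
        ∑ i ∈ Finset.Icc 1 n, if i ≤ lam.parts.count m then (i : ℚ) ^ (l - 1) else 0 := by
      intro lam
      rw [← Finset.sum_filter, faulhaber]
      refine Finset.sum_congr ?_ fun _ _ => rfl
      ext i
      have := mult_le ⟨n, lam⟩ m hm1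
      simp only [Finset.mem_Icc, Finset.mem_filter, mult] at this ⊢
      omega
    simp only [h1]
    rw [Finset.sum_comm]
    refine Finset.sum_congr rfl fun i _ => ?_
    rw [← Finset.sum_filter, Finset.sum_const, card_partition_le_count n m i hm1, nsmul_eq_mul,
      mul_comm]
  rw [hL, PowerSeries.coeff_mul]
  simp only [divisorSeries, PowerSeries.coeff_mk, hone, Finset.sum_mul]
  rw [← Finset.sum_product', Finset.sum_sigma']
  have hfilter : ∑ p ∈ Finset.Icc 1 n ×ˢ Finset.Icc 1 n, (p.1 : ℚ) ^ k * (p.2 : ℚ) ^ (l - 1) *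
      ((if p.1 * p.2 ≤ n then Fintype.card (n - p.1 * p.2).Partition else 0 : ℕ) : ℚ) =
      ∑ p ∈ (Finset.Icc 1 n ×ˢ Finset.Icc 1 n).filter (fun p => p.1 * p.2 ≤ n),
        (p.1 : ℚ) ^ k * (p.2 : ℚ) ^ (l - 1) * (Fintype.card (n - p.1 * p.2).Partition : ℚ) := by
    rw [Finset.sum_filter]
    refine Finset.sum_congr rfl fun p _ => ?_
    split_ifs <;> simp
  rw [hfilter]
  refine Finset.sum_nbij' (fun p => ⟨(p.1 * p.2, n - p.1 * p.2), p⟩) (fun x => x.2) ?_ ?_ ?_ ?_ ?_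
  · rintro ⟨m, i⟩ h
    simp only [Finset.mem_filter, Finset.mem_product, Finset.mem_Icc] at h
    simp only [Finset.mem_sigma, Finset.HasAntidiagonal.mem_antidiagonal,
      Nat.mem_divisorsAntidiagonal]
    have := Nat.mul_pos h.1.1.1 h.1.2.1
    exact ⟨by omega, trivial, by omega⟩
  · rintro ⟨⟨N, r⟩, m, i⟩ h
    simp only [Finset.mem_sigma, Finset.HasAntidiagonal.mem_antidiagonal,
      Nat.mem_divisorsAntidiagonal] at h
    simp only [Finset.mem_filter, Finset.mem_product, Finset.mem_Icc]
    obtain ⟨h1, rfl, h3⟩ := h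
    have hm : 1 ≤ m := Nat.pos_of_ne_zero (left_ne_zero_of_mul h3)
    have hi : 1 ≤ i := Nat.pos_of_ne_zero (right_ne_zero_of_mul h3)
    have := Nat.le_mul_of_pos_right m hi
    have := Nat.le_mul_of_pos_left i hm
    omega
  · intro p _; rfl
  · rintro ⟨⟨N, r⟩, m, i⟩ h
    simp only [Finset.mem_sigma, Finset.HasAntidiagonal.mem_antidiagonal,
      Nat.mem_divisorsAntidiagonal] at h
    obtain ⟨h1, rfl, h3⟩ := h
    obtain rfl : r = n - m * i := by omega
    rfl
  · intro p _; rfl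

theorem qGen_add (f g : Ptn → ℚ) : qGen (f + g) = qGen f + qGen g := by
  ext n
  simp [qGen, Finset.sum_add_distrib]

theorem qGen_const (c : ℚ) : qGen (fun _ => c) = PowerSeries.C c * qGen 1 := by
  ext n
  simp [qGen, mul_comm]

theorem qBracket_eq {f : Ptn → ℚ} {G : PowerSeries ℚ} (h : qGen f = G * qGen 1) :
    qBracket f = G := by
  rw [qBracket, h, mul_assoc, PowerSeries.mul_inv_cancel _ constantCoeff_qGen_one, mul_one]

theorem qBracket_const (c : ℚ) : qBracket (fun _ => c) = PowerSeries.C c :=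
  qBracket_eq (qGen_const c)

theorem qBracket_T (k l : ℕ) (hl : 1 ≤ l) : qBracket (T k l) =
    PowerSeries.C (-(bernoulli (k + l) / (2 * (k + l : ℚ))) *
      ((if l = 1 then 1 else 0) + (if k = 0 then 1 else 0))) + divisorSeries k (l - 1) := by
  refine qBracket_eq ?_
  rw [add_mul, ← qGen_const, ← qGen_moment, ← qGen_add]
  congr 1
  funext lam
  have h1 : 0 ≤ (k : ℤ) ∧ 1 ≤ (l : ℤ) := by omega
  have h2 : ((k : ℤ) + l).toNat = k + l := by omega
  rw [T, if_pos h1, h2]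
  simp

/-! ## The numerator of the one-point function -/

/-- The terms at `(m, n)` and `(-m, -n)` combine with the factor `1 - (-1)^(i+j)`. This is the
source of the condition that `k + l` be even, as `i = k` and `j = l - 1`. -/
theorem coeff_lambert (e : Vars 1 →₀ ℕ) : MvPowerSeries.coeff e lambert =
    if Odd (e (.inl 0) + e (.inr 0)) then
      PowerSeries.C (2 / (((e (.inl 0)).factorial : ℚ) * ((e (.inr 0)).factorial : ℚ))) *
        divisorSeries (e (.inl 0)) (e (.inr 0)) else 0 := by
  set i := e (.inl 0)
  set j := e (.inr 0)
  have h1 : HasSum (fun p : ℤ × ℤ => kerReg p.1 p.2 * PowerSeries.C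
      ((p.1 : ℚ) ^ i / i.factorial * ((p.2 : ℚ) ^ j / j.factorial)))
      (MvPowerSeries.coeff e lambert) := by
    have hl : HasSum (fun p : ℤ × ℤ => MvPowerSeries.C (kerReg p.1 p.2) * ex p.1 p.2) lambert :=
      (null_kerReg.summable_C_mul fun p : ℤ × ℤ => ex p.1 p.2).hasSum
    have := MvPowerSeries.WithPiTopology.hasSum_iff_hasSum_coeff.1 hl e
    simpa only [MvPowerSeries.coeff_C_mul, coeff_ex] using this
  ext N
  have h2 := ((PowerSeries.WithPiTopology.hasSum_iff_hasSum_coeff ℚ).1 h1) N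
  have h3 : HasSum (fun p : ℤ × ℤ => PowerSeries.coeff N (kerReg p.1 p.2 * PowerSeries.C
      ((p.1 : ℚ) ^ i / i.factorial * ((p.2 : ℚ) ^ j / j.factorial))))
      (∑ p ∈ Int.divisorsAntidiag N, PowerSeries.coeff N (kerReg p.1 p.2 * PowerSeries.C
      ((p.1 : ℚ) ^ i / i.factorial * ((p.2 : ℚ) ^ j / j.factorial)))) := by
    refine hasSum_sum_of_ne_finset_zero fun p hp => ?_
    rw [PowerSeries.coeff_mul_C, coeff_kerReg, if_neg, if_neg, zero_mul]
    · rintro ⟨h, h', h''⟩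
      exact hp (Int.mem_divisorsAntidiag.2 ⟨h, h ▸ (mul_pos_of_neg_of_neg h' h'').ne'⟩)
    · rintro ⟨h, h', h''⟩
      exact hp (Int.mem_divisorsAntidiag.2 ⟨h, h ▸ (mul_pos h' h'').ne'⟩)
  rw [h2.unique h3, Int.divisorsAntidiag_natCast, Finset.sum_disjUnion, Finset.sum_map,
    Finset.sum_map, ← Finset.sum_add_distrib]
  have h4 : ∀ p ∈ N.divisorsAntidiagonal,
      PowerSeries.coeff N (kerReg p.1 p.2 * PowerSeries.C
        (((p.1 : ℤ) : ℚ) ^ i / i.factorial * (((p.2 : ℤ) : ℚ) ^ j / j.factorial))) +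
      PowerSeries.coeff N (kerReg (-p.1) (-p.2) * PowerSeries.C
        (((-p.1 : ℤ) : ℚ) ^ i / i.factorial * (((-p.2 : ℤ) : ℚ) ^ j / j.factorial))) =
      (if Odd (i + j) then 2 / ((i.factorial : ℚ) * j.factorial) else 0) *
        ((p.1 : ℚ) ^ i * (p.2 : ℚ) ^ j) := by
    rintro ⟨m, n⟩ hp
    rw [Nat.mem_divisorsAntidiagonal] at hp
    obtain ⟨rfl, h0⟩ := hp
    dsimp only at h0 ⊢
    have hm : 0 < m := Nat.pos_of_ne_zero (left_ne_zero_of_mul h0)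
    have hn : 0 < n := Nat.pos_of_ne_zero (right_ne_zero_of_mul h0)
    rw [PowerSeries.coeff_mul_C, PowerSeries.coeff_mul_C, coeff_kerReg, coeff_kerReg,
      if_pos ⟨by push_cast; ring, by omega, by omega⟩, if_neg (by omega),
      if_pos ⟨by push_cast; ring, by omega, by omega⟩]
    push_cast
    rw [neg_pow (m : ℚ), neg_pow (n : ℚ)]
    have hs : (-1 : ℚ) ^ i * (-1) ^ j = if Odd (i + j) then -1 else 1 := by
      rw [← pow_add]
      split_ifs with h
      · exact h.neg_one_pow
      · exact (Nat.not_odd_iff_even.1 h).neg_one_pow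
    have e : 1 * ((m : ℚ) ^ i / i.factorial * ((n : ℚ) ^ j / j.factorial)) +
        -1 * ((-1) ^ i * (m : ℚ) ^ i / i.factorial * ((-1) ^ j * (n : ℚ) ^ j / j.factorial)) =
        (1 - (-1) ^ i * (-1) ^ j) / ((i.factorial : ℚ) * j.factorial) *
          ((m : ℚ) ^ i * (n : ℚ) ^ j) := by
      field_simp
      ring
    rw [e, hs]
    split_ifs <;> norm_num
  refine (Finset.sum_congr rfl h4).trans ?_
  rw [← Finset.mul_sum]
  split_ifs
  · rw [PowerSeries.coeff_C_mul, divisorSeries, PowerSeries.coeff_mk]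
  · rw [zero_mul, map_zero]

/-- `(z/2) coth (z/2)`. -/
def cothSeries : PowerSeries (PowerSeries ℚ) :=
  bernoulliPowerSeries (PowerSeries ℚ) + PowerSeries.C (PowerSeries.C (1 / 2)) * PowerSeries.X

theorem coeff_cothSeries (n : ℕ) : PowerSeries.coeff n cothSeries =
    PowerSeries.C (if n = 1 then 0 else bernoulli n / n.factorial) := by
  rw [cothSeries, map_add, bernoulliPowerSeries, PowerSeries.coeff_mk,
    PowerSeries.coeff_C_mul, PowerSeries.coeff_X, PowerSeries.algebraMap_apply]
  split_ifs with h
  · subst h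
    rw [mul_one, bernoulli_one, ← map_add]
    norm_num
  · simp

theorem coeff_cothSeries_of_odd {n : ℕ} (hn : Odd n) : PowerSeries.coeff n cothSeries = 0 := by
  rw [coeff_cothSeries]
  split_ifs with h
  · simp
  · have : n ≠ 0 := by rintro rfl; simp at hn
    rw [bernoulli_eq_zero_of_odd hn (by omega), zero_div, map_zero]

theorem exp_sub_one_mul_cothSeries : (PowerSeries.exp (PowerSeries ℚ) - 1) * cothSeries * 2 =
    PowerSeries.X * (PowerSeries.exp (PowerSeries ℚ) + 1) := by
  have h := bernoulliPowerSeries_mul_exp_sub_one (PowerSeries ℚ)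
  have h2 : (PowerSeries.C (PowerSeries.C (1 / 2 : ℚ)) : PowerSeries (PowerSeries ℚ)) * 2 = 1 := by
    rw [← map_ofNat (PowerSeries.C (R := PowerSeries ℚ)) 2, ← map_ofNat (PowerSeries.C (R := ℚ)) 2,
      ← map_mul, ← map_mul]
    norm_num
  rw [cothSeries]
  linear_combination 2 * h + (PowerSeries.exp (PowerSeries ℚ) - 1) * PowerSeries.X * h2

/-- The series `2 u v F_1`. -/
def numer : UV := -(inU cothSeries * inV PowerSeries.X) - inU PowerSeries.X * inV cothSeries +
  inU PowerSeries.X * inV PowerSeries.X * lambert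

theorem inU_X : inU PowerSeries.X = MvPowerSeries.X (.inl 0) :=
  PowerSeries.subst_X (PowerSeries.HasSubst.X _)

theorem inV_X : inV PowerSeries.X = MvPowerSeries.X (.inr 0) :=
  PowerSeries.subst_X (PowerSeries.HasSubst.X _)

theorem inU_one : inU 1 = 1 := by
  rw [inU, ← PowerSeries.coe_substAlgHom (PowerSeries.HasSubst.X _), map_one]

theorem inV_one : inV 1 = 1 := by
  rw [inV, ← PowerSeries.coe_substAlgHom (PowerSeries.HasSubst.X _), map_one]

theorem inU_coth : (ex 1 0 - 1) * inU cothSeries * 2 = inU PowerSeries.X * (ex 1 0 + 1) := by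
  have h := congrArg (PowerSeries.substAlgHom (R := PowerSeries ℚ)
    (PowerSeries.HasSubst.X (S := PowerSeries ℚ) (.inl 0 : Vars 1))) exp_sub_one_mul_cothSeries
  simp only [map_mul, map_add, map_sub, map_one, map_ofNat,
    PowerSeries.coe_substAlgHom (PowerSeries.HasSubst.X _)] at h
  rw [ex, expMul_zero, expMul_one, inV_one, mul_one]
  exact h

theorem inV_coth : (ex 0 1 - 1) * inV cothSeries * 2 = inV PowerSeries.X * (ex 0 1 + 1) := by
  have h := congrArg (PowerSeries.substAlgHom (R := PowerSeries ℚ)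
    (PowerSeries.HasSubst.X (S := PowerSeries ℚ) (.inr 0 : Vars 1))) exp_sub_one_mul_cothSeries
  simp only [map_mul, map_add, map_sub, map_one, map_ofNat,
    PowerSeries.coe_substAlgHom (PowerSeries.HasSubst.X _)] at h
  rw [ex, expMul_zero, expMul_one, inU_one, one_mul]
  exact h

theorem two_ne_zero_UV : (2 : UV) ≠ 0 := by
  intro h
  have h1 := congrArg (fun f : UV => PowerSeries.coeff 0 (MvPowerSeries.coeff 0 f)) h
  simp only [map_zero] at h1
  rw [← map_ofNat (MvPowerSeries.C (σ := Vars 1) (R := PowerSeries ℚ)) 2,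
    MvPowerSeries.coeff_zero_C, ← map_ofNat (PowerSeries.C (R := ℚ)) 2,
    PowerSeries.coeff_zero_C] at h1
  norm_num at h1

theorem one_sub_ex_ne_zero : (1 - ex 1 0) * (1 - ex 0 1) ≠ 0 := by
  refine mul_ne_zero ?_ ?_
  · intro h
    have h1 := congrArg (MvPowerSeries.coeff (Finsupp.single (.inl 0) 1)) h
    rw [map_sub, coeff_ex, MvPowerSeries.coeff_one, map_zero, if_neg (by simp)] at h1
    simp at h1
  · intro h
    have h1 := congrArg (MvPowerSeries.coeff (Finsupp.single (.inr 0) 1)) h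
    rw [map_sub, coeff_ex, MvPowerSeries.coeff_one, map_zero, if_neg (by simp)] at h1
    simp at h1

theorem jacU_mul_jacV_mul_numer : jacU * jacV * numer =
    -(inU PowerSeries.X * inV PowerSeries.X * (MvPowerSeries.C jacDeriv * jacUV)) := by
  -- This is `-½ coth(u/2) - ½ coth(v/2) = (1 - x y) / ((1 - x)(1 - y))` with denominators cleared.
  have h1 : (1 - ex 1 0) * (1 - ex 0 1) * numer = inU PowerSeries.X * inV PowerSeries.X *
      ((1 - ex 1 0) * (1 - ex 0 1) * lambert + (1 - ex 1 1)) := by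
    have e11 : ex 1 1 = ex 1 0 * ex 0 1 := by
      rw [ex_mul]
      norm_num
    refine mul_left_cancel₀ two_ne_zero_UV ?_
    rw [numer, e11]
    linear_combination (1 - ex 0 1) * inV PowerSeries.X * inU_coth +
      (1 - ex 1 0) * inU PowerSeries.X * inV_coth
  refine mul_left_cancel₀ one_sub_ex_ne_zero ?_
  linear_combination jacU * jacV * h1 +
    inU PowerSeries.X * inV PowerSeries.X * jacU_mul_jacV_mul

/-- Multiplication by `u v` shifts exponents by one, so `e` belongs to `k = e_u - 1`, `l = e_v`. The
poles of the two cotangents give `T_{-1,1}` and `T_{0,0}`, their other coefficients give the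
Bernoulli constants. -/
theorem coeff_numer (e : Vars 1 →₀ ℕ) : MvPowerSeries.coeff e numer =
    if Even ((e (.inl 0) : ℤ) - 1 + e (.inr 0)) then
      PowerSeries.C (2 / ((fact (e (.inl 0) - 1) : ℚ) * (fact (e (.inr 0) - 1) : ℚ))) *
        qBracket (T (e (.inl 0) - 1) (e (.inr 0)))
    else 0 := by
  have hX : inU PowerSeries.X * inV PowerSeries.X = (MvPowerSeries.monomial
      (Finsupp.single (.inl 0) 1 + Finsupp.single (.inr 0) 1) 1 : UV) := by
    rw [inU_X, inV_X, MvPowerSeries.X, MvPowerSeries.X, MvPowerSeries.monomial_mul_monomial,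
      one_mul]
  have hle : Finsupp.single (.inl 0) 1 + Finsupp.single (.inr 0) 1 ≤ e ↔
      1 ≤ e (.inl 0) ∧ 1 ≤ e (.inr 0) := by
    constructor
    · intro h
      exact ⟨by simpa using h (.inl 0), by simpa using h (.inr 0)⟩
    · rintro ⟨h1, h2⟩ (s | s) <;> rw [Subsingleton.elim s 0] <;> simpa
  have hmain : MvPowerSeries.coeff e numer =
      -(PowerSeries.coeff (e (.inl 0)) cothSeries * if e (.inr 0) = 1 then 1 else 0) -
      (if e (.inl 0) = 1 then 1 else 0) * PowerSeries.coeff (e (.inr 0)) cothSeries +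
      if 1 ≤ e (.inl 0) ∧ 1 ≤ e (.inr 0) then MvPowerSeries.coeff
        (e - (Finsupp.single (.inl 0) 1 + Finsupp.single (.inr 0) 1)) lambert else 0 := by
    rw [numer, hX, map_add, map_sub, map_neg, MvPowerSeries.coeff_monomial_mul]
    simp only [hle, one_mul]
    rw [inU, inV, inU, inV, coeff_subst_mul_subst, coeff_subst_mul_subst, PowerSeries.coeff_X,
      PowerSeries.coeff_X]
  rw [hmain, coeff_lambert]
  simp only [Finsupp.coe_tsub, Finsupp.coe_add, Pi.sub_apply, Pi.add_apply, Finsupp.single_eq_same,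
    ne_eq, reduceCtorEq, not_false_eq_true, Finsupp.single_eq_of_ne, add_zero, zero_add]
  generalize e (.inl 0) = i
  generalize e (.inr 0) = j
  have hT0 : ∀ a b : ℤ, (a = 0 ∧ b = 0) ∨ (a = -1 ∧ b = 1) → T a b = fun _ => -1 / 2 := by
    intro a b h
    funext lam
    rw [T, if_neg (by omega), if_pos h]
  have hT1 : ∀ a b : ℤ, ¬(0 ≤ a ∧ 1 ≤ b) → ¬((a = 0 ∧ b = 0) ∨ (a = -1 ∧ b = 1)) →
      qBracket (T a b) = 0 := by
    intro a b h h'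
    rw [← qBracket_zero]
    congr 1
    funext lam
    rw [T, if_neg h, if_neg h']
    rfl
  have hfact : ∀ n : ℕ, fact ((n + 1 : ℕ) - 1) = n.factorial := by
    intro n
    rw [fact]
    congr 1
    omega
  rcases i with _ | k
  · rw [if_neg (show ¬((0 : ℕ) = 1) by omega), if_neg (show ¬(1 ≤ 0 ∧ 1 ≤ j) by omega),
      coeff_cothSeries, if_neg (show ¬((0 : ℕ) = 1) by omega)]
    by_cases hj : j = 1
    · subst hj
      rw [if_pos rfl, if_pos (by simp), hT0 _ _ (by simp), qBracket_const, ← map_mul, zero_mul,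
        mul_one, sub_zero, add_zero, ← map_neg]
      congr 1
      norm_num [fact]
    · rw [if_neg hj, hT1 _ _ (by omega) (by omega)]
      simp
  rcases j with _ | l
  · rw [if_neg (show ¬((0 : ℕ) = 1) by omega), if_neg (show ¬(1 ≤ k + 1 ∧ 1 ≤ 0) by omega),
      coeff_cothSeries 0, if_neg (show ¬((0 : ℕ) = 1) by omega)]
    by_cases hk : k = 0
    · subst hk
      rw [if_pos rfl, if_pos (by simp), hT0 _ _ (by simp), qBracket_const, ← map_mul, one_mul,
        mul_zero, neg_zero, zero_sub, add_zero, ← map_neg]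
      congr 1
      norm_num [fact]
    · rw [if_neg (show ¬(k + 1 = 1) by omega), hT1 _ _ (by omega) (by omega)]
      simp
  have hpar : Even (((k + 1 : ℕ) : ℤ) - 1 + (l + 1 : ℕ)) ↔ Odd (k + l) := by
    rw [← Int.odd_coe_nat]
    push_cast
    rw [show (k : ℤ) + 1 - 1 + (l + 1) = (k + l) + 1 by ring, Int.even_add_one,
      Int.not_even_iff_odd]
  have hcast : (((k + 1 : ℕ) : ℤ) - 1) = (k : ℤ) := by push_cast; ring
  rw [if_pos (show 1 ≤ k + 1 ∧ 1 ≤ l + 1 by omega), if_congr hpar rfl rfl, hfact, hfact]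
  simp only [add_tsub_cancel_right, hcast]
  by_cases hodd : Odd (k + l)
  · rw [if_pos hodd, if_pos hodd, qBracket_T k (l + 1) (by omega), mul_add,
      add_tsub_cancel_right, ← map_mul, coeff_cothSeries, coeff_cothSeries]
    congr 1
    have hk := k.factorial_ne_zero
    have hl := l.factorial_ne_zero
    by_cases h0 : l = 0
    · subst h0
      have hk0 : k ≠ 0 := by rintro rfl; simp at hodd
      simp only [hk0, zero_add, add_eq_right, if_true, if_false, mul_one, zero_mul, sub_zero,
        add_zero, ← map_neg, Nat.factorial_succ]
      congr 1
      push_cast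
      field_simp
      simp
    · by_cases h1 : k = 0
      · subst h1
        simp only [h0, zero_add, add_eq_right, if_true, if_false, mul_one, mul_zero, neg_zero,
          zero_sub, one_mul, ← map_neg, Nat.factorial_succ]
        congr 1
        push_cast
        field_simp
        ring
      · simp [h0, h1]
  -- In the excluded parity the cotangent terms vanish as well, `(z/2) coth(z/2)` being even.
  · rw [if_neg hodd, if_neg hodd, add_zero]
    by_cases h0 : l = 0
    · subst h0
      rw [coeff_cothSeries_of_odd (by rw [Nat.odd_add_one]; simpa using hodd),
        coeff_cothSeries_of_odd (n := 0 + 1) (by simp)]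
      simp
    · by_cases h1 : k = 0
      · subst h1
        rw [coeff_cothSeries_of_odd (n := l + 1) (by rw [Nat.odd_add_one]; simpa using hodd),
          coeff_cothSeries_of_odd (n := 0 + 1) (by simp)]
        simp
      · simp [h0, h1]

/-! ## The theta series -/

/-- `q^(1/8)`. -/
def qEighth : K := HahnSeries.single (1 / 8) 1

theorem ofPowerSeries_monomial (n : ℕ) (c : ℚ) :
    HahnSeries.ofPowerSeries ℚ ℚ (PowerSeries.monomial n c) = HahnSeries.single (n : ℚ) c := by
  rw [← mul_one c, ← smul_eq_mul, map_smul, ← PowerSeries.X_pow_eq, PowerSeries.smul_eq_C_mul,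
    map_mul, HahnSeries.ofPowerSeries_C, HahnSeries.ofPowerSeries_X_pow, HahnSeries.C_apply,
    HahnSeries.single_mul_single]
  simp

theorem null_jac_mul_C (j : ℕ) :
    Null fun i : ℤ => jac i * PowerSeries.C (((i : ℚ) + 1 / 2) ^ j / j.factorial) :=
  null_jac.mul_right _

/-- The coefficients of `q^(-1/8) θ`. -/
def jacCoeff (j : ℕ) : PowerSeries ℚ :=
  ∑' i : ℤ, jac i * PowerSeries.C (((i : ℚ) + 1 / 2) ^ j / j.factorial)

theorem coeff_jacCoeff (N j : ℕ) : PowerSeries.coeff N (jacCoeff j) =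
    ∑ᶠ i : ℤ, PowerSeries.coeff N
      (jac i * PowerSeries.C (((i : ℚ) + 1 / 2) ^ j / j.factorial)) := by
  have h := (PowerSeries.WithPiTopology.hasSum_iff_hasSum_coeff ℚ).1
    (null_jac_mul_C j).summable.hasSum N
  rw [jacCoeff, ← h.tsum_eq, tsum_eq_finsum (null_jac_mul_C j N)]

theorem thetaFamily_apply (j : ℕ) (i : ℤ) : thetaFamily j i = qEighth *
    HahnSeries.ofPowerSeries ℚ ℚ (jac i * PowerSeries.C (((i : ℚ) + 1 / 2) ^ j / j.factorial)) := by
  have h1 : ⌊(i : ℚ) + 1 / 2⌋ = i := by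
    rw [Int.floor_eq_iff]
    constructor <;> linarith
  have h2 : ((i : ℚ) + 1 / 2) ^ 2 / 2 = 1 / 8 + (tri i : ℚ) := by
    have : 2 * (tri i : ℚ) = i * (i + 1) := by exact_mod_cast two_mul_tri i
    linarith
  change HahnSeries.single (((i : ℚ) + 1 / 2) ^ 2 / 2) ((-1) ^ ⌊(i : ℚ) + 1 / 2⌋ *
    PowerSeries.coeff j (PowerSeries.rescale ((i : ℚ) + 1 / 2) (PowerSeries.exp ℚ))) = _
  rw [h1, h2, jac, map_mul (HahnSeries.ofPowerSeries ℚ ℚ), ofPowerSeries_monomial, HahnSeries.ofPowerSeries_C,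
    HahnSeries.C_apply, HahnSeries.single_mul_single, qEighth, HahnSeries.single_mul_single,
    PowerSeries.coeff_rescale, PowerSeries.coeff_exp, add_zero, one_mul]
  simp [div_eq_mul_inv]

/-- Links the two notions of sum: `hsum` and the `tsum` of a null family are both finite sums in
each power of `q`. Exponents outside `1/8 + ℕ` contribute to neither side. -/
theorem coeff_theta (j : ℕ) : PowerSeries.coeff j theta =
    qEighth * HahnSeries.ofPowerSeries ℚ ℚ (jacCoeff j) := by
  rw [theta, PowerSeries.coeff_mk]
  ext g
  rw [HahnSeries.SummableFamily.coeff_hsum]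
  simp only [thetaFamily_apply]
  have hshift : ∀ x : K, (qEighth * x).coeff g = x.coeff (g - 1 / 8) := by
    intro x
    have := HahnSeries.coeff_single_mul_add (r := (1 : ℚ)) (x := x) (a := g - 1 / 8) (b := 1 / 8)
    rw [sub_add_cancel, one_mul] at this
    exact this
  simp only [hshift]
  by_cases hg : ∃ N : ℕ, (N : ℚ) = g - 1 / 8
  · obtain ⟨N, hN⟩ := hg
    simp only [← hN, HahnSeries.ofPowerSeries_apply_coeff, coeff_jacCoeff]
  · have h0 : ∀ f : PowerSeries ℚ, (HahnSeries.ofPowerSeries ℚ ℚ f).coeff (g - 1 / 8) = 0 := by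
      intro f
      rw [HahnSeries.ofPowerSeries_apply]
      refine HahnSeries.embDomain_of_notMem_range ?_
      rintro ⟨N, hN⟩
      exact hg ⟨N, hN⟩
    simp only [h0, finsum_zero]

theorem jacCoeff_zero : jacCoeff 0 = 0 := by
  rw [← tsum_jac, jacCoeff]
  exact tsum_congr fun i => by simp

theorem jacCoeff_one : jacCoeff 1 = jacDeriv := by
  rw [jacCoeff, jacDeriv]
  exact tsum_congr fun i => by simp

theorem thetaDerivZero_eq : thetaDerivZero = qEighth * HahnSeries.ofPowerSeries ℚ ℚ jacDeriv := by
  rw [thetaDerivZero, ← PowerSeries.coeff_zero_eq_constantCoeff_apply, PowerSeries.coeff_derivative,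
    coeff_theta, jacCoeff_one]
  simp

theorem constantCoeff_jacDeriv : PowerSeries.coeff 0 jacDeriv = 1 := by
  have h := (PowerSeries.WithPiTopology.hasSum_iff_hasSum_coeff ℚ).1
    (null_jac_mul_C 1).summable.hasSum 0
  have h' : HasSum (fun i : ℤ => PowerSeries.coeff 0
      (jac i * PowerSeries.C (((i : ℚ) + 1 / 2) ^ 1 / (1 : ℕ).factorial)))
      (∑ i ∈ ({0, -1} : Finset ℤ), PowerSeries.coeff 0
      (jac i * PowerSeries.C (((i : ℚ) + 1 / 2) ^ 1 / (1 : ℕ).factorial))) := by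
    -- Only `i = 0` and `i = -1` reach `q^0`; each contributes `1/2`.
    refine hasSum_sum_of_ne_finset_zero fun i hi => ?_
    have : tri i ≠ 0 := by
      intro h0
      have : tri i = tri 0 := by rw [h0]; rfl
      rw [tri_eq_iff] at this
      simp at hi
      omega
    rw [PowerSeries.coeff_mul_C, coeff_jac, if_neg this.symm, zero_mul]
  rw [← jacCoeff_one, jacCoeff, h.unique h', Finset.sum_pair (by norm_num)]
  simp only [PowerSeries.coeff_mul_C, coeff_jac]
  norm_num [tri]

theorem thetaDerivZero_ne_zero : thetaDerivZero ≠ 0 := by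
  rw [thetaDerivZero_eq]
  refine mul_ne_zero (HahnSeries.single_ne_zero one_ne_zero) ?_
  rw [Ne, map_eq_zero_iff _ HahnSeries.ofPowerSeries_injective]
  intro h
  have := constantCoeff_jacDeriv
  rw [h, map_zero] at this
  exact zero_ne_one this

/-- Extension of scalars from power series in `q` to series in rational powers of `q`. -/
def mapK : UV →+* MvPowerSeries (Vars 1) K :=
  MvPowerSeries.map (HahnSeries.ofPowerSeries ℚ ℚ)

theorem coeff_tsum_ex (a b : ℤ → ℚ) (e : Vars 1 →₀ ℕ) :
    MvPowerSeries.coeff e (∑' i : ℤ, MvPowerSeries.C (jac i) * ex (a i) (b i)) =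
      ∑' i : ℤ, jac i * PowerSeries.C (a i ^ e (.inl 0) / (e (.inl 0)).factorial *
        (b i ^ e (.inr 0) / (e (.inr 0)).factorial)) := by
  have h := MvPowerSeries.WithPiTopology.hasSum_iff_hasSum_coeff.1
    (null_jac.summable_C_mul fun i : ℤ => ex (a i) (b i)).hasSum e
  rw [← h.tsum_eq]
  simp only [MvPowerSeries.coeff_C_mul, coeff_ex]

theorem eq_single_inl_iff (e : Vars 1 →₀ ℕ) :
    e = Finsupp.single (.inl 0) (e (.inl 0)) ↔ e (.inr 0) = 0 := by
  constructor
  · intro h; rw [h]; simp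
  · intro h
    ext s
    rcases s with s | s <;> rw [Subsingleton.elim s 0] <;> simp [h]

theorem eq_single_inr_iff (e : Vars 1 →₀ ℕ) :
    e = Finsupp.single (.inr 0) (e (.inr 0)) ↔ e (.inl 0) = 0 := by
  constructor
  · intro h; rw [h]; simp
  · intro h
    ext s
    rcases s with s | s <;> rw [Subsingleton.elim s 0] <;> simp [h]

theorem subst_u_theta : PowerSeries.subst u theta = MvPowerSeries.C qEighth * mapK jacU := by
  classical
  refine MvPowerSeries.ext fun e => ?_
  rw [MvPowerSeries.coeff_C_mul, mapK, MvPowerSeries.coeff_map, jacU, coeff_tsum_ex, u,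
    PowerSeries.coeff_subst_single, coeff_theta]
  split_ifs with h
  · rw [eq_single_inl_iff] at h
    simp [h, jacCoeff]
  · rw [eq_single_inl_iff] at h
    simp [h]

theorem subst_v_theta : PowerSeries.subst v theta = MvPowerSeries.C qEighth * mapK jacV := by
  classical
  refine MvPowerSeries.ext fun e => ?_
  rw [MvPowerSeries.coeff_C_mul, mapK, MvPowerSeries.coeff_map, jacV, coeff_tsum_ex, v,
    PowerSeries.coeff_subst_single, coeff_theta]
  split_ifs with h
  · rw [eq_single_inr_iff] at h
    simp [h, jacCoeff]
  · rw [eq_single_inr_iff] at h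
    simp [h]

theorem coeff_add_pow (d : ℕ) (e : Vars 1 →₀ ℕ) : MvPowerSeries.coeff e ((u + v) ^ d) =
    if d = e (.inl 0) + e (.inr 0) then (d.choose (e (.inl 0)) : K) else 0 := by
  have hpow : ∀ m n : ℕ, MvPowerSeries.coeff e (u ^ m * v ^ n) =
      (if e (.inl 0) = m then 1 else 0) * if e (.inr 0) = n then (1 : K) else 0 := by
    intro m n
    have h := coeff_subst_mul_subst (R := K) (PowerSeries.X ^ m) (PowerSeries.X ^ n) e
    rw [PowerSeries.subst_pow (PowerSeries.HasSubst.X _),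
      PowerSeries.subst_pow (PowerSeries.HasSubst.X _),
      PowerSeries.subst_X (PowerSeries.HasSubst.X _),
      PowerSeries.subst_X (PowerSeries.HasSubst.X _), PowerSeries.coeff_X_pow,
      PowerSeries.coeff_X_pow] at h
    exact h
  rw [add_pow, map_sum]
  have hterm : ∀ m, MvPowerSeries.coeff e (u ^ m * v ^ (d - m) * (d.choose m : MvPowerSeries (Vars 1) K)) =
      if e (.inl 0) = m then (if e (.inr 0) = d - m then (d.choose m : K) else 0) else 0 := by
    intro m
    rw [← map_natCast (MvPowerSeries.C (σ := Vars 1) (R := K)), mul_comm,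
      MvPowerSeries.coeff_C_mul, hpow]
    split_ifs <;> simp
  simp only [hterm]
  rw [Finset.sum_ite_eq]
  simp only [Finset.mem_range]
  split_ifs <;> first | rfl | omega

theorem hasSubst_add : PowerSeries.HasSubst (u + v) :=
  (PowerSeries.HasSubst.X _).add (PowerSeries.HasSubst.X _)

/-- Coefficientwise this is `e^(ν(u+v)) = e^(νu) e^(νv)`, that is, `choose (a+b) a / (a+b)! = 1 /
(a! b!)`. -/
theorem subst_add_theta :
    PowerSeries.subst (u + v) theta = MvPowerSeries.C qEighth * mapK jacUV := by
  refine MvPowerSeries.ext fun e => ?_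
  rw [MvPowerSeries.coeff_C_mul, mapK, MvPowerSeries.coeff_map, jacUV, coeff_tsum_ex,
    PowerSeries.coeff_subst hasSubst_add, finsum_eq_single _ (e (.inl 0) + e (.inr 0))]
  · rw [coeff_add_pow, if_pos rfl, coeff_theta, smul_eq_mul, mul_assoc, ← map_natCast
      (HahnSeries.ofPowerSeries ℚ ℚ), ← map_mul, jacCoeff,
      ← (null_jac_mul_C _).summable.tsum_mul_right]
    congr 2
    refine tsum_congr fun i => ?_
    rw [← map_natCast (PowerSeries.C (R := ℚ)), mul_assoc, ← map_mul]
    congr 2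
    generalize e (.inl 0) = a
    generalize e (.inr 0) = b
    have hc : (((a + b).choose a : ℕ) : ℚ) * a.factorial * b.factorial = (a + b).factorial := by
      have := Nat.choose_mul_factorial_mul_factorial (Nat.le_add_right a b)
      rw [Nat.add_sub_cancel_left] at this
      exact_mod_cast this
    have ha : (a.factorial : ℚ) ≠ 0 := by exact_mod_cast a.factorial_ne_zero
    have hb : (b.factorial : ℚ) ≠ 0 := by exact_mod_cast b.factorial_ne_zero
    have hab : ((a + b).factorial : ℚ) ≠ 0 := by exact_mod_cast (a + b).factorial_ne_zero
    rw [div_mul_div_comm, ← pow_add, div_mul_eq_mul_div, div_eq_div_iff hab (mul_ne_zero ha hb)]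
    linear_combination ((i : ℚ) + 1 / 2) ^ (a + b) * hc
  · intro d hd
    rw [coeff_add_pow, if_neg hd, smul_zero]

/-! ## The one-point function -/

theorem ofMvPowerSeries_coeff (f : MvPowerSeries (Vars 1) K) (e : Vars 1 →₀ ℕ) :
    (ofMvPowerSeries (Vars 1) f).coeff (fun s => (e s : ℤ)) = MvPowerSeries.coeff e f :=
  HahnSeries.embDomain_coeff (f := ⟨⟨_, _⟩, _⟩)

theorem ofMvPowerSeries_coeff_eq_zero (f : MvPowerSeries (Vars 1) K) (e : Vars 1 → ℤ)
    (s : Vars 1) (hs : e s < 0) : (ofMvPowerSeries (Vars 1) f).coeff e = 0 := by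
  refine HahnSeries.embDomain_of_notMem_range (f := ⟨⟨_, _⟩, _⟩) ?_
  rintro ⟨a, rfl⟩
  have : (0 : ℤ) ≤ (a s : ℤ) := Int.natCast_nonneg _
  exact absurd hs (not_lt.2 this)

theorem exists_eq_natCast {e : Vars 1 → ℤ} (he : ∀ s, 0 ≤ e s) :
    ∃ n : Vars 1 →₀ ℕ, e = fun s => (n s : ℤ) := by
  refine ⟨Finsupp.equivFunOnFinite.symm fun s => (e s).toNat, ?_⟩
  funext s
  simp [he s]

theorem ofMvPowerSeries_monomial (d : Vars 1 →₀ ℕ) (c : K) :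
    ofMvPowerSeries (Vars 1) (MvPowerSeries.monomial d c) =
      HahnSeries.single (fun s => (d s : ℤ)) c := by
  classical
  ext1
  funext e
  by_cases he : ∀ s, 0 ≤ e s
  · obtain ⟨n, rfl⟩ := exists_eq_natCast he
    rw [ofMvPowerSeries_coeff, MvPowerSeries.coeff_monomial]
    split_ifs with h
    · rw [h, HahnSeries.coeff_single_same]
    · refine (HahnSeries.coeff_single_of_ne fun h' => h ?_).symm
      ext s
      exact_mod_cast congrFun h' s
  · push Not at he
    obtain ⟨s, hs⟩ := he
    rw [ofMvPowerSeries_coeff_eq_zero _ _ s hs, HahnSeries.coeff_single_of_ne]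
    rintro rfl
    exact absurd hs (not_lt.2 (Int.natCast_nonneg _))

theorem ofMvPowerSeries_X (s : Vars 1) : IsUnit (ofMvPowerSeries (Vars 1) (MvPowerSeries.X s)) := by
  rw [MvPowerSeries.X, ofMvPowerSeries_monomial]
  refine IsUnit.of_mul_eq_one (HahnSeries.single (-fun t => ((Finsupp.single s 1 t : ℕ) : ℤ)) 1) ?_
  rw [HahnSeries.single_mul_single, add_neg_cancel, one_mul]
  rfl

/-- Since `θ(0) = 0` and `θ'(0) ≠ 0`, `θ(z)` is `z` times an invertible power series, and variables
are invertible among Laurent series. -/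
theorem isUnit_thetaAt_X (s : Vars 1) : IsUnit (thetaAt (MvPowerSeries.X s)) := by
  classical
  have h0 : PowerSeries.constantCoeff theta = 0 := by
    rw [← PowerSeries.coeff_zero_eq_constantCoeff_apply, coeff_theta, jacCoeff_zero, map_zero,
      mul_zero]
  obtain ⟨g, hg⟩ := PowerSeries.X_dvd_iff.2 h0
  have hg0 : PowerSeries.coeff 0 g = thetaDerivZero := by
    rw [thetaDerivZero, ← PowerSeries.coeff_zero_eq_constantCoeff_apply,
      PowerSeries.coeff_derivative, hg, PowerSeries.coeff_succ_X_mul]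
    simp
  rw [thetaAt, hg, PowerSeries.subst_mul (PowerSeries.HasSubst.X _),
    PowerSeries.subst_X (PowerSeries.HasSubst.X _), map_mul]
  refine (ofMvPowerSeries_X s).mul (IsUnit.map _ ?_)
  rw [MvPowerSeries.isUnit_iff_constantCoeff, ← MvPowerSeries.coeff_zero_eq_constantCoeff_apply,
    PowerSeries.coeff_subst_single, if_pos (by simp), Finsupp.coe_zero, Pi.zero_apply, hg0]
  exact isUnit_iff_ne_zero.2 thetaDerivZero_ne_zero

theorem two_mul_X_mul_X_mul_F_one : 2 * (ofMvPowerSeries (Vars 1) (mapK (inU PowerSeries.X)) *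
    ofMvPowerSeries (Vars 1) (mapK (inV PowerSeries.X))) * F 1 =
    ofMvPowerSeries (Vars 1) (mapK numer) := by
  have hX : 2 * (ofMvPowerSeries (Vars 1) (mapK (inU PowerSeries.X)) *
      ofMvPowerSeries (Vars 1) (mapK (inV PowerSeries.X))) =
      HahnSeries.single (1 : Vars 1 → ℤ) (2 : K) := by
    rw [inU_X, inV_X, mapK, MvPowerSeries.map_X, MvPowerSeries.map_X, ← map_mul, MvPowerSeries.X,
      MvPowerSeries.X, MvPowerSeries.monomial_mul_monomial, ofMvPowerSeries_monomial, one_mul]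
    have h2 : (2 : Laurent (Vars 1)) = HahnSeries.single 0 2 := by
      rw [← HahnSeries.C_apply, map_ofNat]
    have ha : (fun s : Vars 1 => (((Finsupp.single (.inl 0) 1 + Finsupp.single (.inr 0) 1 :
        Vars 1 →₀ ℕ) s : ℕ) : ℤ)) = 1 := by
      funext s
      rcases s with s | s <;> rw [Subsingleton.elim s 0] <;> simp
    rw [h2, HahnSeries.single_mul_single, zero_add, mul_one, ha]
  rw [hX]
  ext1
  funext e
  obtain ⟨e, rfl⟩ : ∃ e' : Vars 1 → ℤ, e = e' + 1 := ⟨e - 1, by simp⟩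
  rw [HahnSeries.coeff_single_mul_add]
  by_cases he : ∀ s, 0 ≤ (e + 1) s
  · obtain ⟨n, hn⟩ := exists_eq_natCast he
    have e0 : e (.inl 0) = (n (.inl 0) : ℤ) - 1 := by
      have := congrFun hn (.inl 0)
      simp only [Pi.add_apply, Pi.one_apply] at this
      omega
    have e1 : e (.inr 0) = (n (.inr 0) : ℤ) - 1 := by
      have := congrFun hn (.inr 0)
      simp only [Pi.add_apply, Pi.one_apply] at this
      omega
    rw [hn, ofMvPowerSeries_coeff, mapK, MvPowerSeries.coeff_map, coeff_numer, F_one_coeff, e0, e1,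
      sub_add_cancel]
    split_ifs with h
    · rw [map_mul, HahnSeries.ofPowerSeries_C, HahnSeries.C_mul_eq_smul, div_eq_mul_inv, mul_smul,
        ← bracket, Nat.cast_mul, ofNat_smul_eq_nsmul, nsmul_eq_mul, Nat.cast_ofNat]
    · rw [map_zero, mul_zero]
  · push Not at he
    obtain ⟨s, hs⟩ := he
    rw [ofMvPowerSeries_coeff_eq_zero _ _ s hs, F_one_coeff_eq_zero e s, mul_zero]
    simp only [Pi.add_apply, Pi.one_apply] at hs
    omega

theorem two_ne_zero_K : (2 : K) ≠ 0 := by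
  rw [← map_ofNat (HahnSeries.C (Γ := ℚ) (R := ℚ)) 2]
  exact HahnSeries.single_ne_zero two_ne_zero

theorem F_one_mul_thetaAt : F 1 * (thetaAt u * thetaAt v) =
    const (-1 / 2) * (const thetaDerivZero * thetaAt (u + v)) := by
  have hC : ∀ c : K, ofMvPowerSeries (Vars 1) (MvPowerSeries.C c) = const c := by
    intro c
    rw [← MvPowerSeries.monomial_zero_eq_C_apply, ofMvPowerSeries_monomial]
    rfl
  have hmapC : ∀ c : PowerSeries ℚ, mapK (MvPowerSeries.C c) =
      MvPowerSeries.C (HahnSeries.ofPowerSeries ℚ ℚ c) := fun c => MvPowerSeries.map_C _ _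
  have hmain := congrArg (fun f => ofMvPowerSeries (Vars 1) (mapK f)) jacU_mul_jacV_mul_numer
  simp only [map_mul, map_neg, ← two_mul_X_mul_X_mul_F_one, hmapC, hC] at hmain
  rw [thetaAt, thetaAt, thetaAt, subst_u_theta, subst_v_theta, subst_add_theta, thetaDerivZero_eq]
  simp only [map_mul, hC]
  have hunit : IsUnit (2 * (ofMvPowerSeries (Vars 1) (mapK (inU PowerSeries.X)) *
      ofMvPowerSeries (Vars 1) (mapK (inV PowerSeries.X)))) := by
    have h2 : IsUnit (2 : Laurent (Vars 1)) := by
      rw [← map_ofNat (const (σ := Vars 1)) 2]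
      exact IsUnit.map _ (isUnit_iff_ne_zero.2 two_ne_zero_K)
    refine h2.mul (IsUnit.mul ?_ ?_)
    · rw [inU_X, mapK, MvPowerSeries.map_X]
      exact ofMvPowerSeries_X _
    · rw [inV_X, mapK, MvPowerSeries.map_X]
      exact ofMvPowerSeries_X _
  have hhalf : (2 : Laurent (Vars 1)) * const (-1 / 2 : K) = -1 := by
    rw [← map_ofNat (const (σ := Vars 1)) 2, ← map_mul, ← map_one (const (σ := Vars 1)), ← map_neg]
    congr 1
    rw [mul_div_cancel₀ _ two_ne_zero_K]
  refine hunit.mul_left_cancel ?_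
  -- Both sides carry `q^(1/4)`: one factor `q^(1/8)` from each of `θ(u)`, `θ(v)`, and one from each
  -- of `θ'(0)`, `θ(u+v)`.
  linear_combination const qEighth ^ 2 * hmain -
    ofMvPowerSeries (Vars 1) (mapK (inU PowerSeries.X)) *
      ofMvPowerSeries (Vars 1) (mapK (inV PowerSeries.X)) * const qEighth ^ 2 *
      const (HahnSeries.ofPowerSeries ℚ ℚ jacDeriv) *
      ofMvPowerSeries (Vars 1) (mapK jacUV) * hhalf

end PartitionBracket

end

theorem mainTheorem8 :
    (∀ n : ℕ, PartitionBracket.F n =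
      ∏ i : Fin n, PartitionBracket.rename (PartitionBracket.pair i) (PartitionBracket.F 1)) ∧
    (IsUnit (PartitionBracket.thetaAt PartitionBracket.u *
        PartitionBracket.thetaAt PartitionBracket.v) ∧
      PartitionBracket.F 1 =
        PartitionBracket.const (-1 / 2) *
          (PartitionBracket.const PartitionBracket.thetaDerivZero *
            PartitionBracket.thetaAt (PartitionBracket.u + PartitionBracket.v)) *
          Ring.inverse (PartitionBracket.thetaAt PartitionBracket.u *
            PartitionBracket.thetaAt PartitionBracket.v)) ∧
    PartitionBracket.Phi =
      PowerSeries.subst PartitionBracket.exponentSeries (PowerSeries.exp PartitionBracket.K) := by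
  have hunit := (PartitionBracket.isUnit_thetaAt_X (.inl 0)).mul
    (PartitionBracket.isUnit_thetaAt_X (.inr 0))
  refine ⟨PartitionBracket.F_eq_prod, ⟨hunit, ?_⟩, PartitionBracket.Phi_eq⟩
  rw [← PartitionBracket.F_one_mul_thetaAt, mul_assoc]
  exact (mul_one _).symm.trans (congrArg _ (Ring.mul_inverse_cancel _ hunit).symm)
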